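/- Let $(M,g)$ be a connected smooth Lorentzian manifold (Hausdorff, second countable, without boundary), and let $\mathfrak{k}$ be its Killing algebra, i.e. the Lie algebra, under the Lie bracket of vector fields, of all smooth vector fields $K$ on $M$ with $L_K g = 0$. Let $\mathfrak{r}$ be the radical of $\mathfrak{k}$ (its largest solvable ideal, so that $\mathfrak{k}=\mathfrak{s}\ltimes\mathfrak{r}$ with $\mathfrak{s}$ semisimple is the Levi decomposition). Let $\mathcal{H}\subset M$ be a nonempty, injectively immersed (for example embedded) smooth hypersurface that is null, i.e. $g|_{T_a\mathcal{H}}$ is degenerate for every $a\in\mathcal{H}$. Suppose that $\mathcal{H}$ is a Killing horizon, i.e. there is $K\in\mathfrak{k}$ with $g(K,K)|_{\mathcal{H}}=0$ and $K_a\in T_a\mathcal{H}\setminus\{0\}$ for every $a\in\mathcal{H}$, and that $\mathcal{H}$ is $\mathfrak{k}$-invariant, i.e. $X_a\in T_a\mathcal{H}$ for all $X\in\mathfrak{k}$ and $a\in\mathcal{H}$. Call $K\in\mathfrak{k}$ a generator of $\mathcal{H}$ if $g(K,K)|_{\mathcal{H}}=0$ and $K_a\in T_a\mathcal{H}\setminus\{0\}$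 for all $a$ in an open dense subset of $\mathcal{H}$, and let $\mathfrak{a}_{\mathcal{H}}\subset\mathfrak{k}$ be the set consisting of all generators of $\mathcal{H}$ and the zero vector field. Then $\mathfrak{a}_{\mathcal{H}}$ is an ideal of $\mathfrak{k}$ and $\mathfrak{a}_{\mathcal{H}}\subseteq\mathfrak{r}$. In particular, $\mathfrak{r}\neq\{0\}$. -/

import Mathlib

open Set Function Bundle VectorField Filter
open scoped Manifold ContDiff Topology

noncomputable section

/-! ### The Lie algebra of smooth vector fields on a manifold -/

section VectorFields

variable (d : ℕ) (M : Type*) [TopologicalSpace M] [ChartedSpace (EuclideanSpace ℝ (Fin d)) M]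
  [IsManifold (𝓡 d) ∞ M]

/-- Smooth vector fields on a smooth `d`-dimensional manifold `M` (without boundary). -/
abbrev SmoothVectorField : Type _ :=
  ContMDiffSection (𝓡 d) (EuclideanSpace ℝ (Fin d)) ∞ (TangentSpace (𝓡 d) : M → Type _)

variable {d M}

theorem isManifold_minSmoothness (k : ℕ) : IsManifold (𝓡 d) (minSmoothness ℝ k) M :=
  IsManifold.of_le (n := ∞) (by simpa using mod_cast le_top)

/-- On an open set, the Lie bracket of smooth vector fields is smooth. -/
theorem contMDiffOn_mlieBracket {U : Set M} (hU : IsOpen U)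
    {X Y : ∀ x : M, TangentSpace (𝓡 d) x}
    (hX : ContMDiffOn (𝓡 d) (𝓡 d).tangent ∞ (fun x ↦ (⟨x, X x⟩ : TangentBundle (𝓡 d) M)) U)
    (hY : ContMDiffOn (𝓡 d) (𝓡 d).tangent ∞ (fun x ↦ (⟨x, Y x⟩ : TangentBundle (𝓡 d) M)) U) :
    ContMDiffOn (𝓡 d) (𝓡 d).tangent ∞
      (fun x ↦ (⟨x, mlieBracket (𝓡 d) X Y x⟩ : TangentBundle (𝓡 d) M)) U := by
  have := isManifold_minSmoothness (d := d) (M := M) 2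
  have : IsManifold (𝓡 d) (((⊤ : ℕ∞) : WithTop ℕ∞) + 1) M := by
    simpa using (inferInstance : IsManifold (𝓡 d) ∞ M)
  intro x hx
  exact (ContMDiffAt.mlieBracket_vectorField (m := ⊤) (n := ⊤)
    (hX.contMDiffAt (hU.mem_nhds hx)) (hY.contMDiffAt (hU.mem_nhds hx))
    (by simp)).contMDiffWithinAt

/-- The Lie bracket of smooth vector fields. -/
instance SmoothVectorField.instBracket :
    Bracket (SmoothVectorField d M) (SmoothVectorField d M) where
  bracket X Y :=
    { toFun := mlieBracket (𝓡 d) X Y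
      contMDiff_toFun := contMDiffOn_univ.1 (contMDiffOn_mlieBracket isOpen_univ
        X.contMDiff.contMDiffOn Y.contMDiff.contMDiffOn) }

theorem SmoothVectorField.lie_apply (X Y : SmoothVectorField d M) (x : M) :
    ⁅X, Y⁆ x = mlieBracket (𝓡 d) X Y x := rfl

instance SmoothVectorField.instLieRing : LieRing (SmoothVectorField d M) where
  add_lie X Y Z := by
    ext x
    exact mlieBracket_add_left (W := Z) X.mdifferentiableAt Y.mdifferentiableAt
  lie_add X Y Z := by
    ext x
    exact mlieBracket_add_right (V := X) Y.mdifferentiableAt Z.mdifferentiableAt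
  lie_self X := by
    ext x
    simp [SmoothVectorField.lie_apply]
  leibniz_lie X Y Z := by
    ext x
    have := isManifold_minSmoothness (d := d) (M := M) 3
    have h2 : minSmoothness ℝ 2 ≤ ∞ := by
      rw [minSmoothness_of_isRCLikeNormedField]
      exact WithTop.coe_le_coe.2 (le_top : (2 : ℕ∞) ≤ ⊤)
    exact leibniz_identity_mlieBracket_apply (X.contMDiff.of_le h2 x)
      (Y.contMDiff.of_le h2 x) (Z.contMDiff.of_le h2 x)

instance SmoothVectorField.instLieAlgebra : LieAlgebra ℝ (SmoothVectorField d M) where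
  lie_smul c X Y := by
    ext x
    exact mlieBracket_const_smul_right (V := X) Y.mdifferentiableAt

theorem mvfderiv_apply_congr {f f' : M → ℝ} {x : M} (h : f =ᶠ[𝓝 x] f')
    (v : TangentSpace (𝓡 d) x) : mvfderiv (𝓡 d) f x v = mvfderiv (𝓡 d) f' x v := by
  have e : (mfderiv (𝓡 d) 𝓘(ℝ, ℝ) f x : TangentSpace (𝓡 d) x →L[ℝ] ℝ) =
    mfderiv (𝓡 d) 𝓘(ℝ, ℝ) f' x := h.mfderiv_eq
  exact DFunLike.congr_fun e v

/-- The Lie bracket with `h Z`, differentiated once more. -/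
theorem mlieBracket_mlieBracket_smul (X Y Z : SmoothVectorField d M) {h : M → ℝ} {x : M}
    (hh : ∀ᶠ y in 𝓝 x, MDifferentiableAt (𝓡 d) 𝓘(ℝ, ℝ) h y)
    (hYh : MDifferentiableAt (𝓡 d) 𝓘(ℝ, ℝ) (fun y ↦ mvfderiv (𝓡 d) h y (Y y)) x) :
    mlieBracket (𝓡 d) X (mlieBracket (𝓡 d) Y (h • ⇑Z)) x =
      mvfderiv (𝓡 d) (fun y ↦ mvfderiv (𝓡 d) h y (Y y)) x (X x) • Z x
      + mvfderiv (𝓡 d) h x (Y x) • mlieBracket (𝓡 d) X Z x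
      + (mvfderiv (𝓡 d) h x (X x) • mlieBracket (𝓡 d) Y Z x
      + h x • mlieBracket (𝓡 d) X (mlieBracket (𝓡 d) Y Z) x) := by
  have e : mlieBracket (𝓡 d) Y (h • ⇑Z) =ᶠ[𝓝 x]
      (((fun y ↦ mvfderiv (𝓡 d) h y (Y y)) • ⇑Z) + (h • ⇑⁅Y, Z⁆)) := by
    filter_upwards [hh] with y hy
    exact mlieBracket_smul_right hy Z.mdifferentiableAt
  have e' := EventuallyEq.mlieBracket_vectorField_eq (EventuallyEq.refl (𝓝 x) ⇑X) e
  refine e'.trans ?_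
  rw [mlieBracket_add_right (hYh.smul_section Z.mdifferentiableAt)
      (hh.self_of_nhds.smul_section ⁅Y, Z⁆.mdifferentiableAt),
    mlieBracket_smul_right hYh Z.mdifferentiableAt,
    mlieBracket_smul_right hh.self_of_nhds ⁅Y, Z⁆.mdifferentiableAt]
  rfl

/-- `[X, Y] h = X (Y h) - Y (X h)`. -/
theorem mvfderiv_mlieBracket (X Y : SmoothVectorField d M) {h : M → ℝ} {x : M}
    (hh₂ : ContMDiffAt (𝓡 d) 𝓘(ℝ, ℝ) ∞ h x)
    (hh : ∀ᶠ y in 𝓝 x, MDifferentiableAt (𝓡 d) 𝓘(ℝ, ℝ) h y)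
    (hXh : MDifferentiableAt (𝓡 d) 𝓘(ℝ, ℝ) (fun y ↦ mvfderiv (𝓡 d) h y (X y)) x)
    (hYh : MDifferentiableAt (𝓡 d) 𝓘(ℝ, ℝ) (fun y ↦ mvfderiv (𝓡 d) h y (Y y)) x) :
    mvfderiv (𝓡 d) h x (mlieBracket (𝓡 d) X Y x) =
      mvfderiv (𝓡 d) (fun y ↦ mvfderiv (𝓡 d) h y (Y y)) x (X x) -
        mvfderiv (𝓡 d) (fun y ↦ mvfderiv (𝓡 d) h y (X y)) x (Y x) := by
  -- If `Z x ≠ 0`, compare the coefficients of `Z` in the Jacobi identity for `X`, `Y`, `h Z`.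
  have key : ∀ Z : SmoothVectorField d M,
      (mvfderiv (𝓡 d) h x (mlieBracket (𝓡 d) X Y x)) • Z x =
      (mvfderiv (𝓡 d) (fun y ↦ mvfderiv (𝓡 d) h y (Y y)) x (X x) -
        mvfderiv (𝓡 d) (fun y ↦ mvfderiv (𝓡 d) h y (X y)) x (Y x)) • Z x := by
    intro Z
    have := isManifold_minSmoothness (d := d) (M := M) 3
    have h2 : minSmoothness ℝ 2 ≤ ∞ := by
      rw [minSmoothness_of_isRCLikeNormedField]
      exact WithTop.coe_le_coe.2 (le_top : (2 : ℕ∞) ≤ ⊤)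
    have J := leibniz_identity_mlieBracket_apply (U := X) (V := Y) (W := h • ⇑Z)
      (X.contMDiff.of_le h2 x) (Y.contMDiff.of_le h2 x)
      ((hh₂.smul_section (Z.contMDiff x)).of_le h2)
    have J' := leibniz_identity_mlieBracket_apply (U := X) (V := Y) (W := Z)
      (X.contMDiff.of_le h2 x) (Y.contMDiff.of_le h2 x) (Z.contMDiff.of_le h2 x)
    rw [mlieBracket_mlieBracket_smul X Y Z hh hYh, mlieBracket_mlieBracket_smul Y X Z hh hXh,
      mlieBracket_smul_right hh.self_of_nhds Z.mdifferentiableAt, J', smul_add] at J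
    rw [sub_smul, eq_sub_iff_add_eq]
    have J2 := sub_eq_zero.2 J
    rw [← sub_eq_zero, ← neg_eq_zero, ← J2]
    abel
  by_cases hX : X x = 0
  · by_cases hY : Y x = 0
    · have h0 : mlieBracket (𝓡 d) X Y x = 0 := by
        rw [← mlieBracketWithin_univ]
        exact mlieBracketWithin_eq_zero_of_eq_zero hX hY
      rw [h0, hX, hY]
      simp
    · exact smul_left_injective ℝ hY (key Y)
  · exact smul_left_injective ℝ hX (key X)

end VectorFields

/-! ### Lorentzian metrics and Killing vector fields -/

section Lorentzian

variable {d : ℕ} {M : Type*} [TopologicalSpace M] [ChartedSpace (EuclideanSpace ℝ (Fin d)) M]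
  [IsManifold (𝓡 d) ∞ M]

variable (d M) in
/-- A smooth Lorentzian metric, of signature `(-, +, …, +)`: in each tangent space there is
a vector `v` with `g(v, v) < 0` whose orthogonal complement is positive definite. -/
structure LorentzianMetric where
  /-- The symmetric bilinear form on each tangent space. -/
  form (x : M) : TangentSpace (𝓡 d) x →L[ℝ] TangentSpace (𝓡 d) x →L[ℝ] ℝ
  symm (x : M) (v w : TangentSpace (𝓡 d) x) : form x v w = form x w v
  lorentzian (x : M) : ∃ v : TangentSpace (𝓡 d) x, form x v v < 0 ∧
    ∀ w : TangentSpace (𝓡 d) x, w ≠ 0 → form x v w = 0 → 0 < form x w w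
  contMDiff : ContMDiff (𝓡 d)
    ((𝓡 d).prod 𝓘(ℝ, EuclideanSpace ℝ (Fin d) →L[ℝ] EuclideanSpace ℝ (Fin d) →L[ℝ] ℝ)) ∞
    (fun x ↦ TotalSpace.mk' (EuclideanSpace ℝ (Fin d) →L[ℝ] EuclideanSpace ℝ (Fin d) →L[ℝ] ℝ)
      (E := fun x : M ↦ TangentSpace (𝓡 d) x →L[ℝ] TangentSpace (𝓡 d) x →L[ℝ] ℝ) x (form x))

namespace LorentzianMetric

variable (g : LorentzianMetric d M)

/-- `K` is a Killing vector field, `L_K g = 0`: for all smooth vector fields `Y`, `Z` defined on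
an open set `U`, one has `K (g(Y, Z)) = g([K, Y], Z) + g(Y, [K, Z])` on `U`. -/
def IsKilling (K : SmoothVectorField d M) : Prop :=
  ∀ (U : Set M), IsOpen U → ∀ Y Z : (∀ x : M, TangentSpace (𝓡 d) x),
    ContMDiffOn (𝓡 d) (𝓡 d).tangent ∞ (fun x ↦ (⟨x, Y x⟩ : TangentBundle (𝓡 d) M)) U →
    ContMDiffOn (𝓡 d) (𝓡 d).tangent ∞ (fun x ↦ (⟨x, Z x⟩ : TangentBundle (𝓡 d) M)) U →
    ∀ x ∈ U, mvfderiv (𝓡 d) (fun y ↦ g.form y (Y y) (Z y)) x (K x) =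
      g.form x (mlieBracket (𝓡 d) K Y x) (Z x) + g.form x (Y x) (mlieBracket (𝓡 d) K Z x)

theorem contMDiffOn_form {U : Set M} {Y Z : ∀ x : M, TangentSpace (𝓡 d) x}
    (hY : ContMDiffOn (𝓡 d) (𝓡 d).tangent ∞ (fun x ↦ (⟨x, Y x⟩ : TangentBundle (𝓡 d) M)) U)
    (hZ : ContMDiffOn (𝓡 d) (𝓡 d).tangent ∞ (fun x ↦ (⟨x, Z x⟩ : TangentBundle (𝓡 d) M)) U) :
    ContMDiffOn (𝓡 d) 𝓘(ℝ, ℝ) ∞ (fun y ↦ g.form y (Y y) (Z y)) U := by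
  have : ContMDiffOn (𝓡 d) ((𝓡 d).prod 𝓘(ℝ, ℝ)) ∞
      (fun m ↦ TotalSpace.mk' ℝ (E := Bundle.Trivial M ℝ) m (g.form m (Y m) (Z m))) U :=
    ContMDiffOn.clm_bundle_apply₂ (F₁ := EuclideanSpace ℝ (Fin d))
      (F₂ := EuclideanSpace ℝ (Fin d)) g.contMDiff.contMDiffOn hY hZ
  intro x hx
  exact (contMDiffWithinAt_totalSpace.1 (this x hx)).2

/-- The Killing algebra: the Lie algebra of all (globally defined, smooth) Killing vector
fields. -/
def killingAlgebra : LieSubalgebra ℝ (SmoothVectorField d M) where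
  carrier := {K | g.IsKilling K}
  zero_mem' := by
    intro U hU Y Z hY hZ x hx
    simp
  add_mem' := by
    intro K L hK hL U hU Y Z hY hZ x hx
    have h1 := hK U hU Y Z hY hZ x hx
    have h2 := hL U hU Y Z hY hZ x hx
    have e1 : mlieBracket (𝓡 d) (⇑(K + L)) Y x = _ :=
      mlieBracket_add_left (W := Y) (K.mdifferentiableAt (x := x)) L.mdifferentiableAt
    have e2 : mlieBracket (𝓡 d) (⇑(K + L)) Z x = _ :=
      mlieBracket_add_left (W := Z) (K.mdifferentiableAt (x := x)) L.mdifferentiableAt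
    rw [e1, e2]
    simp only [ContMDiffSection.coe_add, Pi.add_apply, map_add, add_apply,
      h1, h2]
    ring
  smul_mem' := by
    intro c K hK U hU Y Z hY hZ x hx
    have h1 := hK U hU Y Z hY hZ x hx
    have e1 : mlieBracket (𝓡 d) (⇑(c • K)) Y x = _ :=
      mlieBracket_const_smul_left (W := Y) (K.mdifferentiableAt (x := x))
    have e2 : mlieBracket (𝓡 d) (⇑(c • K)) Z x = _ :=
      mlieBracket_const_smul_left (W := Z) (K.mdifferentiableAt (x := x))
    rw [e1, e2]
    simp only [ContMDiffSection.coe_smul, Pi.smul_apply, map_smul, smul_apply,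
      h1, smul_eq_mul]
    ring
  lie_mem' := by
    intro K L hK hL U hU Y Z hY hZ x hx
    have hUx : U ∈ 𝓝 x := hU.mem_nhds hx
    have sK : ∀ {W : ∀ x : M, TangentSpace (𝓡 d) x},
        ContMDiffOn (𝓡 d) (𝓡 d).tangent ∞ (fun x ↦ (⟨x, W x⟩ : TangentBundle (𝓡 d) M)) U → _ :=
      fun hW ↦ contMDiffOn_mlieBracket hU K.contMDiff.contMDiffOn hW
    have sL : ∀ {W : ∀ x : M, TangentSpace (𝓡 d) x},
        ContMDiffOn (𝓡 d) (𝓡 d).tangent ∞ (fun x ↦ (⟨x, W x⟩ : TangentBundle (𝓡 d) M)) U → _ :=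
      fun hW ↦ contMDiffOn_mlieBracket hU L.contMDiff.contMDiffOn hW
    have sm : ∀ {f : M → ℝ}, ContMDiffOn (𝓡 d) 𝓘(ℝ, ℝ) ∞ f U → ∀ y ∈ U,
        MDifferentiableAt (𝓡 d) 𝓘(ℝ, ℝ) f y :=
      fun hf y hy ↦ (hf.contMDiffAt (hU.mem_nhds hy)).mdifferentiableAt (by simp)
    have eK := eventually_of_mem hUx (hK U hU Y Z hY hZ)
    have eL := eventually_of_mem hUx (hL U hU Y Z hY hZ)
    have dK1 := sm (g.contMDiffOn_form (sK hY) hZ) x hx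
    have dK2 := sm (g.contMDiffOn_form hY (sK hZ)) x hx
    have dL1 := sm (g.contMDiffOn_form (sL hY) hZ) x hx
    have dL2 := sm (g.contMDiffOn_form hY (sL hZ)) x hx
    have main := mvfderiv_mlieBracket K L (h := fun y ↦ g.form y (Y y) (Z y)) (x := x)
      ((g.contMDiffOn_form hY hZ).contMDiffAt hUx) (eventually_of_mem hUx (sm (g.contMDiffOn_form hY hZ)))
      ((dK1.add dK2).congr_of_eventuallyEq eK) ((dL1.add dL2).congr_of_eventuallyEq eL)
    rw [mvfderiv_apply_congr eK, mvfderiv_apply_congr eL] at main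
    have a1 : mvfderiv (𝓡 d) (fun y ↦ g.form y (mlieBracket (𝓡 d) L Y y) (Z y)
        + g.form y (Y y) (mlieBracket (𝓡 d) L Z y)) x = _ := mvfderiv_add dL1 dL2
    have a2 : mvfderiv (𝓡 d) (fun y ↦ g.form y (mlieBracket (𝓡 d) K Y y) (Z y)
        + g.form y (Y y) (mlieBracket (𝓡 d) K Z y)) x = _ := mvfderiv_add dK1 dK2
    rw [a1, a2, add_apply, add_apply, hK U hU _ _ (sL hY) hZ x hx, hK U hU _ _ hY (sL hZ) x hx,
      hL U hU _ _ (sK hY) hZ x hx, hL U hU _ _ hY (sK hZ) x hx] at main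
    have := isManifold_minSmoothness (d := d) (M := M) 3
    have h2 : minSmoothness ℝ 2 ≤ ∞ := by
      rw [minSmoothness_of_isRCLikeNormedField]
      exact WithTop.coe_le_coe.2 (le_top : (2 : ℕ∞) ≤ ⊤)
    have jY := leibniz_identity_mlieBracket_apply (K.contMDiff.of_le h2 x)
      (L.contMDiff.of_le h2 x) ((hY.contMDiffAt hUx).of_le h2)
    have jZ := leibniz_identity_mlieBracket_apply (K.contMDiff.of_le h2 x)
      (L.contMDiff.of_le h2 x) ((hZ.contMDiffAt hUx).of_le h2)
    rw [jY, jZ] at main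
    refine main.trans ?_
    change _ = g.form x (mlieBracket (𝓡 d) (mlieBracket (𝓡 d) K L) Y x) (Z x)
      + g.form x (Y x) (mlieBracket (𝓡 d) (mlieBracket (𝓡 d) K L) Z x)
    simp only [map_add, add_apply]
    ring

end LorentzianMetric

end Lorentzian

/-! ### Killing horizons -/

section Horizons

variable {n : ℕ} {M : Type*} [TopologicalSpace M]
  [ChartedSpace (EuclideanSpace ℝ (Fin (n + 1))) M] [IsManifold (𝓡 (n + 1)) ∞ M]
  {N : Type*} [TopologicalSpace N] [ChartedSpace (EuclideanSpace ℝ (Fin n)) N]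

/-- An injectively immersed hypersurface `H = ι(N)` of the `(n + 1)`-dimensional manifold `M`:
the image of a nonempty `n`-dimensional manifold `N` under an injective smooth immersion `ι`.
(Embedded hypersurfaces are the case in which `N` carries the subspace topology.) -/
structure IsHypersurface (n : ℕ) {M N : Type*} [TopologicalSpace M]
    [ChartedSpace (EuclideanSpace ℝ (Fin (n + 1))) M] [TopologicalSpace N]
    [ChartedSpace (EuclideanSpace ℝ (Fin n)) N] (ι : N → M) : Prop where
  nonempty : Nonempty N
  injective : Injective ι
  immersion : Manifold.IsImmersion (𝓡 n) (𝓡 (n + 1)) ∞ ι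

/-- The tangent space `T_a H ⊆ T_a M` of the hypersurface `H = ι(N)` at `a = ι p`. -/
def hypersurfaceTangent (n : ℕ) {M N : Type*} [TopologicalSpace M]
    [ChartedSpace (EuclideanSpace ℝ (Fin (n + 1))) M] [TopologicalSpace N]
    [ChartedSpace (EuclideanSpace ℝ (Fin n)) N] (ι : N → M) (p : N) :
    Submodule ℝ (TangentSpace (𝓡 (n + 1)) (ι p)) :=
  LinearMap.range (mfderiv (𝓡 n) (𝓡 (n + 1)) ι p).toLinearMap

namespace LorentzianMetric

variable (g : LorentzianMetric (n + 1) M) (ι : N → M)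

/-- `H = ι(N)` is a null hypersurface: the metric induced on each of its tangent spaces is
degenerate. -/
def IsNullHypersurface : Prop :=
  IsHypersurface n ι ∧ ∀ p : N, ∃ v ∈ hypersurfaceTangent n ι p, v ≠ 0 ∧
    ∀ w ∈ hypersurfaceTangent n ι p, g.form (ι p) v w = 0

/-- A Killing horizon: a null hypersurface for which there is a Killing vector field that is null,
tangent and nonzero at every point of it. -/
def IsKillingHorizon : Prop :=
  g.IsNullHypersurface ι ∧ ∃ K ∈ g.killingAlgebra, ∀ p : N,
    g.form (ι p) (K (ι p)) (K (ι p)) = 0 ∧ K (ι p) ∈ hypersurfaceTangent n ι p ∧ K (ι p) ≠ 0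

/-- Every Killing vector field is tangent to `H = ι(N)`. -/
def IsKillingInvariant : Prop :=
  ∀ X ∈ g.killingAlgebra, ∀ p : N, X (ι p) ∈ hypersurfaceTangent n ι p

/-- `K` is a generator of the horizon `H = ι(N)`: it is null on all of `H`, and tangent to `H` and
nonzero on an open dense subset of `H` (for the manifold topology of `H`). -/
def IsGenerator (K : SmoothVectorField (n + 1) M) : Prop :=
  (∀ p : N, g.form (ι p) (K (ι p)) (K (ι p)) = 0) ∧
    ∃ V : Set N, IsOpen V ∧ Dense V ∧
      ∀ p ∈ V, K (ι p) ∈ hypersurfaceTangent n ι p ∧ K (ι p) ≠ 0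

/-- The set of all Killing vector fields that are generators of the horizon, together with `0`. -/
def generators : Set g.killingAlgebra :=
  {K | g.IsGenerator ι (K : SmoothVectorField (n + 1) M) ∨ K = 0}

end LorentzianMetric

end Horizons

end

/-! On a null hypersurface the tangent null vectors are exactly the normal ones and form a line at
each point. By invariance, the generators together with 0 are therefore the Killing fields normal to
$\mathcal{H}$. These form an ideal, because bracketing with a tangent Killing field preserves
normality (`lieBracket_normal`). The density condition costs nothing: a Killing field vanishing on
an open piece of $\mathcal{H}$ has zero 1-jet there (`jet_eq_zero`), so it vanishes on the connected
$M$ (`eq_zero_of_jet_eq_zero`).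

Solvability is the main point. Let $L$ be the nowhere vanishing horizon field, fix $p$ in
$\mathcal{H}$, and write $K_p = A(K)L_p$ for normal Killing $K$. Then $A[K_1,K_2] = A(K_1)A[L,K_2] -
A(K_2)A[L,K_1]$. The crucial fact, `IsKillingOn.exists_ad_sq_eq`, is $A[L,[L,K]] = \kappa A[L,K]$,
where $\kappa$ depends on $L$ and $p$ but not on $K$; up to sign it is the surface gravity of $L$.
With the Jacobi identity this gives $A[L,B] = \kappa A(B)$ for every bracket $B$ of normal Killing
fields. Hence $A[B,B'] = \kappa A(B)A(B') - \kappa A(B')A(B) = 0$ for two such brackets. Since $p$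
is arbitrary, $[B,B']$ vanishes on $\mathcal{H}$ and so identically. The ideal is metabelian and
lies in the radical, which is nonzero because it contains $L$. -/

noncomputable section

set_option maxSynthPendingDepth 3

/-! ### Killing fields on open subsets of a vector space -/

section LocalKilling

variable {E : Type*} [NormedAddCommGroup E] [NormedSpace ℝ E]

/-- `X` is a smooth Killing field, on the open subset `U` of a vector space, of the field `G` of
bilinear forms. -/
structure IsKillingOn (G : E → E →L[ℝ] E →L[ℝ] ℝ) (U : Set E) (X : E → E) : Prop where
  contDiffOn : ContDiffOn ℝ ∞ X U
  killing : ∀ x ∈ U, ∀ v w : E,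
    fderiv ℝ G x (X x) v w + G x (fderiv ℝ X x v) w + G x v (fderiv ℝ X x w) = 0

theorem ContDiffOn.hasFDerivAt_of_isOpen {F F' : Type*} [NormedAddCommGroup F] [NormedSpace ℝ F]
    [NormedAddCommGroup F'] [NormedSpace ℝ F'] {f : F → F'} {U : Set F} (hf : ContDiffOn ℝ ∞ f U)
    (hU : IsOpen U) {x : F} (hx : x ∈ U) : HasFDerivAt f (fderiv ℝ f x) x :=
  ((hf.contDiffAt (hU.mem_nhds hx)).differentiableAt (by simp)).hasFDerivAt

theorem ContDiffOn.fderiv_infty {F F' : Type*} [NormedAddCommGroup F] [NormedSpace ℝ F]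
    [NormedAddCommGroup F'] [NormedSpace ℝ F'] {f : F → F'} {U : Set F} (hf : ContDiffOn ℝ ∞ f U)
    (hU : IsOpen U) : ContDiffOn ℝ ∞ (fderiv ℝ f) U :=
  hf.fderiv_of_isOpen hU (by simp)

theorem ContDiffOn.eventually_norm_lt_add_one {F F' : Type*} [NormedAddCommGroup F]
    [NormedSpace ℝ F] [NormedAddCommGroup F'] [NormedSpace ℝ F'] {f : F → F'} {U : Set F}
    (hf : ContDiffOn ℝ ∞ f U) (hU : IsOpen U) {x : F} (hx : x ∈ U) :
    ∀ᶠ y in 𝓝 x, ‖f y‖ < ‖f x‖ + 1 :=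
  (hf.contDiffAt (hU.mem_nhds hx)).continuousAt.norm.eventually_lt_const (lt_add_one _)

variable {G : E → E →L[ℝ] E →L[ℝ] ℝ} {U : Set E} {X : E → E}

namespace IsKillingOn

/-- The derivative of the Killing equation. -/
theorem deriv_killing (hX : IsKillingOn G U X) (hU : IsOpen U) (hG : ContDiffOn ℝ ∞ G U)
    {x : E} (hx : x ∈ U) (w u v : E) :
    G x (fderiv ℝ (fderiv ℝ X) x w u) v + G x u (fderiv ℝ (fderiv ℝ X) x w v) =
      -(fderiv ℝ (fderiv ℝ G) x w (X x) u v + fderiv ℝ G x (fderiv ℝ X x w) u v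
        + fderiv ℝ G x w (fderiv ℝ X x u) v + fderiv ℝ G x w u (fderiv ℝ X x v)) := by
  have dG := hG.hasFDerivAt_of_isOpen hU hx
  have dG' := (hG.fderiv_infty hU).hasFDerivAt_of_isOpen hU hx
  have dX := hX.contDiffOn.hasFDerivAt_of_isOpen hU hx
  have dX' := (hX.contDiffOn.fderiv_infty hU).hasFDerivAt_of_isOpen hU hx
  have c (z : E) := hasFDerivAt_const (𝕜 := ℝ) z x
  have H := ((((dG'.clm_apply dX).clm_apply (c u)).clm_apply (c v)).add
    ((dG.clm_apply (dX'.clm_apply (c u))).clm_apply (c v))).add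
    ((dG.clm_apply (c u)).clm_apply (dX'.clm_apply (c v)))
  have H0 : HasFDerivAt (fun _ : E ↦ (0 : ℝ)) (0 : E →L[ℝ] ℝ) x := hasFDerivAt_const _ _
  have e := eventually_of_mem (hU.mem_nhds hx) fun y hy ↦ (hX.killing y hy u v).symm
  have := DFunLike.congr_fun ((H.congr_of_eventuallyEq e).unique H0) w
  simp at this
  linarith

/-- The second derivative of a Killing field is determined by the first two Taylor coefficients. -/
theorem two_mul_second_deriv (hX : IsKillingOn G U X) (hU : IsOpen U) (hG : ContDiffOn ℝ ∞ G U)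
    (hs : ∀ x ∈ U, ∀ v w, G x v w = G x w v) {x : E} (hx : x ∈ U)
    {Q : E → E → E → ℝ} (hQ : ∀ w u v, Q w u v =
      -(fderiv ℝ (fderiv ℝ G) x w (X x) u v + fderiv ℝ G x (fderiv ℝ X x w) u v
        + fderiv ℝ G x w (fderiv ℝ X x u) v + fderiv ℝ G x w u (fderiv ℝ X x v))) (w u v : E) :
    2 * G x (fderiv ℝ (fderiv ℝ X) x w u) v = Q w u v + Q u w v - Q v w u := by
  have sym (a b : E) : fderiv ℝ (fderiv ℝ X) x a b = fderiv ℝ (fderiv ℝ X) x b a :=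
    ((hX.contDiffOn.contDiffAt (hU.mem_nhds hx)).isSymmSndFDerivAt (by
      rw [minSmoothness_of_isRCLikeNormedField]
      exact WithTop.coe_le_coe.2 (le_top : (2 : ℕ∞) ≤ ⊤))) a b
  -- As for the Koszul formula: three permutations of the differentiated Killing equation, combined
  -- with signs +, +, −, isolate one second derivative because both $G$ and $D^2X$ are symmetric.
  have h1 := hX.deriv_killing hU hG hx w u v
  have h2 := hX.deriv_killing hU hG hx u w v
  have h3 := hX.deriv_killing hU hG hx v w u
  rw [← hQ] at h1 h2 h3
  rw [hs x hx u] at h1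
  rw [hs x hx w, sym u w] at h2
  rw [hs x hx w, sym v w, sym v u] at h3
  linarith

/-- Killing's equation is of finite type: $D^2X$ is linear in $(X, DX)$. The factor 6 is half of
three `Q` terms with four summands each; dividing by `c` inverts $G$. This is the input for
Grönwall's inequality. -/
theorem norm_second_deriv_le (hX : IsKillingOn G U X) (hU : IsOpen U) (hG : ContDiffOn ℝ ∞ G U)
    (hs : ∀ x ∈ U, ∀ v w, G x v w = G x w v) {x : E} (hx : x ∈ U) {c C : ℝ} (hc : 0 < c)
    (hGc : ∀ v, c * ‖v‖ ≤ ‖G x v‖) (h1 : ‖fderiv ℝ G x‖ ≤ C) (h2 : ‖fderiv ℝ (fderiv ℝ G) x‖ ≤ C) :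
    ‖fderiv ℝ (fderiv ℝ X) x‖ ≤ 6 * C / c * max ‖X x‖ ‖fderiv ℝ X x‖ := by
  set m := max ‖X x‖ ‖fderiv ℝ X x‖ with hm
  have hC : 0 ≤ C := (norm_nonneg _).trans h1
  have hm0 : 0 ≤ m := (norm_nonneg _).trans (le_max_left _ _)
  obtain ⟨Q, hQ⟩ : ∃ Q : E → E → E → ℝ, ∀ w u v, Q w u v =
      -(fderiv ℝ (fderiv ℝ G) x w (X x) u v + fderiv ℝ G x (fderiv ℝ X x w) u v
        + fderiv ℝ G x w (fderiv ℝ X x u) v + fderiv ℝ G x w u (fderiv ℝ X x v)) :=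
    ⟨_, fun _ _ _ ↦ rfl⟩
  have b1 (a b e : E) : ‖fderiv ℝ G x a b e‖ ≤ C * ‖a‖ * ‖b‖ * ‖e‖ :=
    ((fderiv ℝ G x a b).le_opNorm e).trans (by
      gcongr
      exact ((fderiv ℝ G x a).le_opNorm b).trans (by
        gcongr
        exact ((fderiv ℝ G x).le_opNorm a).trans (by gcongr)))
  have b2 (a b e f : E) : ‖fderiv ℝ (fderiv ℝ G) x a b e f‖ ≤ C * ‖a‖ * ‖b‖ * ‖e‖ * ‖f‖ :=
    ((fderiv ℝ (fderiv ℝ G) x a b e).le_opNorm f).trans (by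
      gcongr
      exact ((fderiv ℝ (fderiv ℝ G) x a b).le_opNorm e).trans (by
        gcongr
        exact ((fderiv ℝ (fderiv ℝ G) x a).le_opNorm b).trans (by
          gcongr
          exact ((fderiv ℝ (fderiv ℝ G) x).le_opNorm a).trans (by gcongr))))
  have b0 : ‖X x‖ ≤ m := le_max_left _ _
  have bD (a : E) : ‖fderiv ℝ X x a‖ ≤ m * ‖a‖ :=
    ((fderiv ℝ X x).le_opNorm a).trans (by gcongr; exact le_max_right _ _)
  have bQ (w u v : E) : ‖Q w u v‖ ≤ 4 * C * m * ‖w‖ * ‖u‖ * ‖v‖ := by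
    have t1 : ‖fderiv ℝ (fderiv ℝ G) x w (X x) u v‖ ≤ C * ‖w‖ * m * ‖u‖ * ‖v‖ :=
      (b2 _ _ _ _).trans (by gcongr)
    have t2 : ‖fderiv ℝ G x (fderiv ℝ X x w) u v‖ ≤ C * (m * ‖w‖) * ‖u‖ * ‖v‖ :=
      (b1 _ _ _).trans (by gcongr; exact bD w)
    have t3 : ‖fderiv ℝ G x w (fderiv ℝ X x u) v‖ ≤ C * ‖w‖ * (m * ‖u‖) * ‖v‖ :=
      (b1 _ _ _).trans (by gcongr; exact bD u)
    have t4 : ‖fderiv ℝ G x w u (fderiv ℝ X x v)‖ ≤ C * ‖w‖ * ‖u‖ * (m * ‖v‖) :=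
      (b1 _ _ _).trans (by gcongr; exact bD v)
    rw [hQ, norm_neg]
    refine (norm_add_le _ _).trans ((add_le_add_left (norm_add₃_le) _).trans ?_)
    linarith
  refine ContinuousLinearMap.opNorm_le_bound _ (by positivity) fun w ↦ ?_
  refine ContinuousLinearMap.opNorm_le_bound _ (by positivity) fun u ↦ ?_
  have bG : ‖G x (fderiv ℝ (fderiv ℝ X) x w u)‖ ≤ 6 * C * m * ‖w‖ * ‖u‖ := by
    refine ContinuousLinearMap.opNorm_le_bound _ (by positivity) fun v ↦ ?_
    have k := congrArg norm (hX.two_mul_second_deriv hU hG hs hx hQ w u v)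
    rw [norm_mul, Real.norm_ofNat] at k
    have k2 := norm_sub_le (Q w u v + Q u w v) (Q v w u)
    have k3 := norm_add_le (Q w u v) (Q u w v)
    linarith [bQ w u v, bQ u w v, bQ v w u]
  have := (hGc _).trans bG
  have e : 6 * C / c * m * ‖w‖ * ‖u‖ = (6 * C * m * ‖w‖ * ‖u‖) / c := by ring
  rw [e, le_div_iff₀ hc, mul_comm]
  exact this

/-- A Killing field with vanishing first-order Taylor polynomial at one point of a convex open
set vanishes on it, if its second derivative is controlled by the first two Taylor coefficients. -/
theorem eqOn_zero_of_bound {B : Set E} (hB : IsOpen B) (hconv : Convex ℝ B)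
    (hX : ContDiffOn ℝ ∞ X B) {C : ℝ}
    (hC : ∀ x ∈ B, ‖fderiv ℝ (fderiv ℝ X) x‖ ≤ C * max ‖X x‖ ‖fderiv ℝ X x‖)
    {a : E} (ha : a ∈ B) (h0 : X a = 0) (h1 : fderiv ℝ X a = 0) : EqOn X 0 B := by
  intro y hy
  let γ : ℝ → E := fun t ↦ a + t • (y - a)
  have hγ : ∀ t ∈ Icc (0 : ℝ) 1, γ t ∈ B := fun t ht ↦
    hconv.add_smul_sub_mem ha hy ht
  have dγ (t : ℝ) : HasDerivAt γ (y - a) t := by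
    have := ((hasDerivAt_id t).smul_const (y - a)).const_add a
    rwa [one_smul] at this
  have dF : ∀ t ∈ Icc (0 : ℝ) 1, HasDerivAt (fun t ↦ (X (γ t), fderiv ℝ X (γ t)))
      (fderiv ℝ X (γ t) (y - a), fderiv ℝ (fderiv ℝ X) (γ t) (y - a)) t := fun t ht ↦
    ((hX.hasFDerivAt_of_isOpen hB (hγ t ht)).comp_hasDerivAt t (dγ t)).prodMk
      (((hX.fderiv_infty hB).hasFDerivAt_of_isOpen hB (hγ t ht)).comp_hasDerivAt t (dγ t))
  -- Grönwall along the segment from `a` to `y` for the pair $(X, DX)$ in the sup norm. In `max 1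
  -- C`, the 1 bounds the derivative of $X$ and `C` that of $DX$.
  have key := eq_zero_of_abs_deriv_le_mul_abs_self_of_eq_zero_right
    (f := fun t ↦ (X (γ t), fderiv ℝ X (γ t)))
    (f' := fun t ↦ (fderiv ℝ X (γ t) (y - a), fderiv ℝ (fderiv ℝ X) (γ t) (y - a)))
    (K := max 1 C * ‖y - a‖) (a := 0) (b := 1)
    (fun t ht ↦ (dF t ht).continuousAt.continuousWithinAt)
    (fun t ht ↦ (dF t (Ico_subset_Icc_self ht)).hasDerivWithinAt)
    (by simp [γ, h0, h1]) (fun t ht ↦ by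
      have ht' := hγ t (Ico_subset_Icc_self ht)
      have hm : 0 ≤ max ‖X (γ t)‖ ‖fderiv ℝ X (γ t)‖ := (norm_nonneg _).trans (le_max_left _ _)
      rw [Prod.norm_mk, Prod.norm_mk, mul_right_comm]
      refine max_le ?_ ?_
      · refine ((fderiv ℝ X (γ t)).le_opNorm _).trans ?_
        gcongr
        refine (le_max_right ‖X (γ t)‖ _).trans ?_
        exact le_mul_of_one_le_left hm (le_max_left _ _)
      · refine ((fderiv ℝ (fderiv ℝ X) (γ t)).le_opNorm _).trans ?_
        gcongr
        refine (hC _ ht').trans ?_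
        gcongr
        exact le_max_right _ _) 1 (by simp)
  simpa [γ] using congrArg Prod.fst key

/-- Every point has a neighbourhood on which a Killing field of a nondegenerate form is determined
by its first-order Taylor polynomial at any point. -/
theorem exists_ball_unique [FiniteDimensional ℝ E] (hU : IsOpen U) (hG : ContDiffOn ℝ ∞ G U)
    (hs : ∀ x ∈ U, ∀ v w, G x v w = G x w v)
    {x₀ : E} (hx₀ : x₀ ∈ U) (hnd : ∀ v, G x₀ v = 0 → v = 0) :
    ∃ r > 0, Metric.ball x₀ r ⊆ U ∧ ∀ X, IsKillingOn G U X → ∀ a ∈ Metric.ball x₀ r,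
      X a = 0 → fderiv ℝ X a = 0 → EqOn X 0 (Metric.ball x₀ r) := by
  obtain ⟨c, hc, hcG⟩ : ∃ c > 0, ∀ v, c * ‖v‖ ≤ ‖G x₀ v‖ := by
    obtain ⟨K, hK, hA⟩ := LinearMap.exists_antilipschitzWith (G x₀ : E →ₗ[ℝ] (E →L[ℝ] ℝ))
      (LinearMap.ker_eq_bot'.2 hnd)
    refine ⟨(K : ℝ)⁻¹, by positivity, fun v ↦ ?_⟩
    rw [inv_mul_le_iff₀ (by positivity)]
    simpa using hA.le_mul_dist v 0
  have cG : ContinuousAt G x₀ := (hG.contDiffAt (hU.mem_nhds hx₀)).continuousAt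
  -- Continuity keeps these bounds on a ball. Moving $G$ by less than `c / 2` leaves the lower bound
  -- `c / 2`, so $G$ stays uniformly nondegenerate there.
  set C := max (‖fderiv ℝ G x₀‖ + 1) (‖fderiv ℝ (fderiv ℝ G) x₀‖ + 1)
  have e : ∀ᶠ x in 𝓝 x₀, x ∈ U ∧ ‖G x - G x₀‖ < c / 2 ∧ ‖fderiv ℝ G x‖ < ‖fderiv ℝ G x₀‖ + 1 ∧
      ‖fderiv ℝ (fderiv ℝ G) x‖ < ‖fderiv ℝ (fderiv ℝ G) x₀‖ + 1 := by
    refine Filter.Eventually.and (hU.mem_nhds hx₀) ?_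
    refine ((tendsto_iff_norm_sub_tendsto_zero.1 cG).eventually_lt_const (by positivity)).and ?_
    exact ((hG.fderiv_infty hU).eventually_norm_lt_add_one hU hx₀).and
      (((hG.fderiv_infty hU).fderiv_infty hU).eventually_norm_lt_add_one hU hx₀)
  obtain ⟨r, hr, hball⟩ := Metric.eventually_nhds_iff_ball.1 e
  refine ⟨r, hr, fun x hx ↦ (hball x hx).1, fun X hX a ha h0 h1 ↦ ?_⟩
  refine eqOn_zero_of_bound Metric.isOpen_ball (convex_ball _ _)
    (hX.contDiffOn.mono fun x hx ↦ (hball x hx).1) (C := 6 * C / (c / 2)) (fun x hx ↦ ?_) ha h0 h1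
  obtain ⟨hxU, hx1, hx2, hx3⟩ := hball x hx
  refine hX.norm_second_deriv_le hU hG hs hxU (by positivity) (fun v ↦ ?_)
    (hx2.le.trans (le_max_left _ _)) (hx3.le.trans (le_max_right _ _))
  have k1 := hcG v
  have k2 : ‖(G x - G x₀) v‖ ≤ c / 2 * ‖v‖ := ((G x - G x₀).le_opNorm v).trans (by gcongr)
  have k3 : ‖G x₀ v‖ ≤ ‖G x v‖ + ‖(G x - G x₀) v‖ := by
    have : G x₀ v = G x v - (G x - G x₀) v := by simp
    rw [this]
    exact norm_sub_le _ _
  linarith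

end IsKillingOn

/-! ### Killing fields along a hyperplane -/

/-- If `f` takes values in the closed subspace `W` along the affine subspace `x + V`, so do its
derivatives in the directions of `V`. -/
theorem HasFDerivAt.mem_of_eventually_mem {F : Type*} [NormedAddCommGroup F] [NormedSpace ℝ F]
    {f : E → F} {f' : E →L[ℝ] F} {x : E} (hf : HasFDerivAt f f' x) {V : Submodule ℝ E}
    {W : Submodule ℝ F} (hW : IsClosed (W : Set F)) (h : ∀ᶠ y in 𝓝 x, y - x ∈ V → f y ∈ W)
    {v : E} (hv : v ∈ V) : f' v ∈ W := by
  have d : HasDerivAt (fun t : ℝ ↦ f (x + t • v)) (f' v) 0 := by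
    have h1 : HasDerivAt (fun t : ℝ ↦ x + t • v) v 0 := by
      have := ((hasDerivAt_id (0 : ℝ)).smul_const v).const_add x
      rwa [one_smul] at this
    exact HasFDerivAt.comp_hasDerivAt (0 : ℝ) (by simpa using hf) h1
  have c : Tendsto (fun t : ℝ ↦ x + t • v) (𝓝 0) (𝓝 x) := by
    have : Continuous (fun t : ℝ ↦ x + t • v) := by fun_prop
    simpa using this.tendsto 0
  have e : ∀ᶠ t : ℝ in 𝓝 0, f (x + t • v) ∈ W := by
    filter_upwards [c.eventually h] with t ht
    exact ht (by simpa using V.smul_mem t hv)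
  refine hW.mem_of_tendsto d.tendsto_slope_zero ?_
  filter_upwards [nhdsWithin_le_nhds e] with t ht
  refine W.smul_mem _ (W.sub_mem (by simpa using ht) ?_)
  simpa using e.self_of_nhds

namespace IsKillingOn

/-- Allows a multiple of `L` to be subtracted so that the resulting Killing field vanishes at a
given point. -/
theorem sub_smul {Y : E → E} (hX : IsKillingOn G U X) (hY : IsKillingOn G U Y) (hU : IsOpen U)
    (c : ℝ) : IsKillingOn G U (X - c • Y) where
  contDiffOn := hX.contDiffOn.sub (hY.contDiffOn.const_smul c)
  killing x hx v w := by
    have e : fderiv ℝ (X - c • Y) x = fderiv ℝ X x - c • fderiv ℝ Y x :=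
      ((hX.contDiffOn.hasFDerivAt_of_isOpen hU hx).sub
        ((hY.contDiffOn.hasFDerivAt_of_isOpen hU hx).const_smul c)).fderiv
    have h1 := hX.killing x hx v w
    have h2 := hY.killing x hx v w
    rw [e]
    simp only [Pi.sub_apply, Pi.smul_apply, map_sub, map_smul, sub_apply,
      smul_apply, smul_eq_mul]
    linear_combination h1 - c * h2

theorem hasFDerivAt_apply₂ (hG : ContDiffOn ℝ ∞ G U) (hU : IsOpen U) {Y : E → E}
    (hX : ContDiffOn ℝ ∞ X U) (hY : ContDiffOn ℝ ∞ Y U) {x : E} (hx : x ∈ U) :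
    ∃ D : E →L[ℝ] ℝ, HasFDerivAt (fun y ↦ G y (X y) (Y y)) D x ∧ ∀ v, D v =
      fderiv ℝ G x v (X x) (Y x) + G x (fderiv ℝ X x v) (Y x) + G x (X x) (fderiv ℝ Y x v) := by
  refine ⟨_, ((hG.hasFDerivAt_of_isOpen hU hx).clm_apply
    (hX.hasFDerivAt_of_isOpen hU hx)).clm_apply (hY.hasFDerivAt_of_isOpen hU hx), fun v ↦ ?_⟩
  simp
  ring

/-- A Killing field that vanishes along a hyperplane has vanishing first-order Taylor polynomial
there. -/
theorem jet_eq_zero (hX : IsKillingOn G U X) (hU : IsOpen U)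
    (hs : ∀ x ∈ U, ∀ v w, G x v w = G x w v) {x : E} (hx : x ∈ U) (hnd : ∀ v, G x v = 0 → v = 0)
    {V : Submodule ℝ E} {e : E} (hV : ∀ z, ∃ v ∈ V, ∃ c : ℝ, z = v + c • e)
    (h : ∀ᶠ y in 𝓝 x, y - x ∈ V → X y = 0) : X x = 0 ∧ fderiv ℝ X x = 0 := by
  have h0 : X x = 0 := h.self_of_nhds (by simp)
  have h1 : ∀ v ∈ V, fderiv ℝ X x v = 0 := fun v hv ↦ by
    simpa using (hX.contDiffOn.hasFDerivAt_of_isOpen hU hx).mem_of_eventually_mem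
      (W := ⊥) (by simp) (by simpa using h) hv
  -- At a zero of a Killing field its derivative is skew for $G$. As it already kills `V`, skewness
  -- forces the transversal value to be orthogonal to everything.
  have k (v w : E) : G x (fderiv ℝ X x v) w = - G x (fderiv ℝ X x w) v := by
    have := hX.killing x hx v w
    rw [h0, map_zero, hs x hx v] at this
    simp at this
    linarith
  have he : fderiv ℝ X x e = 0 := by
    refine hnd _ (ContinuousLinearMap.ext fun z ↦ ?_)
    obtain ⟨v, hv, c, rfl⟩ := hV z
    have h2 := k e e
    have h3 := k e v
    rw [h1 v hv, map_zero] at h3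
    have h4 : G x (fderiv ℝ X x e) e = 0 := by linarith
    simpa [h4] using h3
  refine ⟨h0, ContinuousLinearMap.ext fun z ↦ ?_⟩
  obtain ⟨v, hv, c, rfl⟩ := hV z
  simp [h1 v hv, he]

/-- If `K` is normal to a hyperplane to which the Killing field `X` is tangent, then so is
`[X, K]`. -/
theorem lieBracket_normal [FiniteDimensional ℝ E] {K : E → E} (hX : IsKillingOn G U X)
    (hK : ContDiffOn ℝ ∞ K U) (hU : IsOpen U) (hG : ContDiffOn ℝ ∞ G U) {x : E} (hx : x ∈ U)
    {V : Submodule ℝ E} (hKV : ∀ᶠ y in 𝓝 x, y - x ∈ V → ∀ v ∈ V, G y (K y) v = 0)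
    (hXV : ∀ᶠ y in 𝓝 x, y - x ∈ V → X y ∈ V) {v : E} (hv : v ∈ V) :
    G x (lieBracket ℝ X K x) v = 0 := by
  have hXx : X x ∈ V := hXV.self_of_nhds (by simp)
  have hDX : fderiv ℝ X x v ∈ V := (hX.contDiffOn.hasFDerivAt_of_isOpen hU hx).mem_of_eventually_mem
    V.closed_of_finiteDimensional hXV hv
  -- Differentiate $G(K,v) = 0$ along the tangent direction $X$, with `v` constant, and subtract the
  -- Killing equation on $(K,v)$. The remaining term $G(K, DX\,v)$ vanishes since $DX\,v$ is again
  -- tangent.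
  obtain ⟨D, hD, eD⟩ := hasFDerivAt_apply₂ hG hU hK (contDiffOn_const (c := v)) hx
  have h1 : D (X x) = 0 := by
    simpa using hD.mem_of_eventually_mem (V := V) (W := ⊥) (by simp)
      (hKV.mono fun y hy h ↦ by simpa using hy h v hv) hXx
  have h2 := hX.killing x hx (K x) v
  have h3 := hKV.self_of_nhds (by simp) _ hDX
  rw [eD] at h1
  simp only [fderiv_fun_const, Pi.zero_apply, zero_apply, map_zero, add_zero] at h1
  simp only [lieBracket, map_sub, sub_apply]
  linarith

/-- On a hyperplane with null normal Killing field `L`, the operator `ad L` on normal Killing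
fields satisfies `(ad L)² = c · ad L` pointwise. -/
theorem exists_ad_sq_eq {L : E → E} (hL : IsKillingOn G U L) (hU : IsOpen U)
    (hG : ContDiffOn ℝ ∞ G U) (hs : ∀ x ∈ U, ∀ v w, G x v w = G x w v) {x : E} (hx : x ∈ U)
    (hnd : ∀ v, G x v = 0 → v = 0) {V : Submodule ℝ E} {e : E}
    (hV : ∀ z, ∃ v ∈ V, ∃ c : ℝ, z = v + c • e) (hLx : L x ≠ 0)
    (hLV : ∀ v ∈ V, G x (L x) v = 0) (hnull : ∀ᶠ y in 𝓝 x, y - x ∈ V → G y (L y) (L y) = 0) :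
    ∃ c : ℝ, ∀ K K' : E → E, IsKillingOn G U K → IsKillingOn G U K' →
      (∀ y ∈ U, K' y = lieBracket ℝ L K y) → ∀ α β γ : ℝ, K x = α • L x → K' x = β • L x →
      lieBracket ℝ L K' x = γ • L x → γ = c * β := by
  have hLe : G x (L x) e ≠ 0 := fun h ↦ hLx <| hnd _ <| ContinuousLinearMap.ext fun z ↦ by
    obtain ⟨v, hv, c, rfl⟩ := hV z
    simp [h, hLV v hv]
  obtain ⟨D, hD, eD⟩ := hasFDerivAt_apply₂ hG hU hL.contDiffOn hL.contDiffOn hx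
  have hDV : ∀ v ∈ V, D v = 0 := fun v hv ↦ by
    simpa using hD.mem_of_eventually_mem (V := V) (W := ⊥) (by simp)
      (hnull.mono fun y hy h ↦ by simpa using hy h) hv
  -- $d(G(L,L))$ and $G(L,\cdot)$ both annihilate the hyperplane `V`, and the latter is nonzero on
  -- `e`, so they are proportional. Up to sign, `m / 2` is the surface gravity.
  obtain ⟨m, hm⟩ : ∃ m, ∀ z, D z = m * G x (L x) z := by
    refine ⟨D e / G x (L x) e, fun z ↦ ?_⟩
    obtain ⟨v, hv, c, rfl⟩ := hV z
    simp only [map_add, map_smul, smul_eq_mul, hDV v hv, hLV v hv]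
    field_simp
    ring
  -- The derivative of a Killing field vanishing at `x`, paired with `L`.
  have skew : ∀ {X : E → E} {b : ℝ}, IsKillingOn G U X → X x = 0 → lieBracket ℝ L X x = b • L x →
      ∀ v, G x (L x) (fderiv ℝ X x v) = - (b * G x (L x) v) := by
    intro X b hX h0 hb v
    have h1 := hX.killing x hx v (L x)
    have h2 : fderiv ℝ X x (L x) = b • L x := by simpa [lieBracket, h0] using hb
    rw [h2, h0, hs x hx _ (L x)] at h1
    simp [hs x hx v] at h1
    linarith
  have br : ∀ {X : E → E}, IsKillingOn G U X → ∀ c : ℝ, ∀ y ∈ U,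
      lieBracket ℝ L (X - c • L) y = lieBracket ℝ L X y := by
    intro X hX c y hy
    have e : fderiv ℝ (X - c • L) y = fderiv ℝ X y - c • fderiv ℝ L y :=
      ((hX.contDiffOn.hasFDerivAt_of_isOpen hU hy).sub
        ((hL.contDiffOn.hasFDerivAt_of_isOpen hU hy).const_smul c)).fderiv
    simp [lieBracket, e]
  refine ⟨m / 2, fun K K' hK hK' hKK' α β γ hα hβ hγ ↦ ?_⟩
  -- Subtracting multiples of `L` makes both fields vanish at `x` without changing their brackets
  -- with `L`, so `skew` applies with `b = β` and `b = γ`.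
  set X := K - α • L with hXdef
  set X' := K' - β • L with hX'def
  have hX : IsKillingOn G U X := hK.sub_smul hL hU α
  have hX' : IsKillingOn G U X' := hK'.sub_smul hL hU β
  have hX0 : X x = 0 := by simp [hXdef, hα]
  have hX'0 : X' x = 0 := by simp [hX'def, hβ]
  have sX := skew hX hX0 (by rw [br hK α x hx, ← hKK' x hx, hβ]) e
  have sX' := skew hX' hX'0 (by rw [br hK' β x hx, hγ]) e
  obtain ⟨D', hD', eD'⟩ := hasFDerivAt_apply₂ hG hU hL.contDiffOn hK'.contDiffOn hx
  have dX' : fderiv ℝ X' x = fderiv ℝ K' x - β • fderiv ℝ L x :=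
    ((hK'.contDiffOn.hasFDerivAt_of_isOpen hU hx).sub
      ((hL.contDiffOn.hasFDerivAt_of_isOpen hU hx).const_smul β)).fderiv
  -- The transversal derivative of $G(L,K')$ is now computed in two ways. Here: the product rule,
  -- with $DK' = DX' + \beta\, DL$ at `x`.
  have first : D' e = (β * m - γ) * G x (L x) e := by
    have h1 := hm e
    rw [eD] at h1
    rw [dX'] at sX'
    rw [eD', hβ]
    simp only [sub_apply, smul_apply, map_sub, map_smul, smul_eq_mul] at sX' ⊢
    linear_combination β * h1 + sX'
  -- Second way: $X(G(L,L)) = -2G(L,[L,X])$ holds on all of `U` and can be differentiated along `e`.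
  -- Since $X$ vanishes at `x`, the Hessian of $G(L,L)$ drops out.
  have second : m * G x (L x) (fderiv ℝ X x e) = -2 * D' e := by
    have hh : ContDiffOn ℝ ∞ (fun y ↦ G y (L y) (L y)) U :=
      (hG.clm_apply hL.contDiffOn).clm_apply hL.contDiffOn
    have d1 := ((hh.fderiv_infty hU).hasFDerivAt_of_isOpen hU hx).clm_apply
      (hX.contDiffOn.hasFDerivAt_of_isOpen hU hx)
    have d2 := hD'.const_mul (-2)
    have ev : ∀ y ∈ U, fderiv ℝ (fun y ↦ G y (L y) (L y)) y (X y) = -2 * G y (L y) (K' y) := by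
      intro y hy
      obtain ⟨Dy, hDy, eDy⟩ := hasFDerivAt_apply₂ hG hU hL.contDiffOn hL.contDiffOn hy
      have h1 := hX.killing y hy (L y) (L y)
      rw [hDy.fderiv, eDy, hKK' y hy, ← br hK α y hy]
      simp only [lieBracket, map_sub]
      rw [hs y hy _ (L y)] at h1 ⊢
      linarith
    have := DFunLike.congr_fun
      (d1.unique (d2.congr_of_eventuallyEq (eventually_of_mem (hU.mem_nhds hx) ev))) e
    rw [hD.fderiv, hX0] at this
    simpa [hm] using this
  rw [sX, first] at second
  have : (γ - m / 2 * β) * G x (L x) e = 0 := by linarith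
  linarith [(mul_eq_zero.1 this).resolve_right hLe]

end IsKillingOn

end LocalKilling

/-! ### Vector fields and metrics in charts -/

section Charts

/-- The model space as a charted space over itself. -/
abbrev chartedSpaceEuclidean (d : ℕ) :
    ChartedSpace (EuclideanSpace ℝ (Fin d)) (EuclideanSpace ℝ (Fin d)) :=
  chartedSpaceSelf _

attribute [local instance] chartedSpaceEuclidean

variable {d : ℕ} {M : Type*} [TopologicalSpace M] [ChartedSpace (EuclideanSpace ℝ (Fin d)) M]

/-- The expression of a vector field in a chart. -/
def chartField (ψ : OpenPartialHomeomorph M (EuclideanSpace ℝ (Fin d)))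
    (X : ∀ x : M, TangentSpace (𝓡 d) x) : EuclideanSpace ℝ (Fin d) → EuclideanSpace ℝ (Fin d) :=
  mpullback (𝓡 d) (𝓡 d) ψ.symm X

/-- The derivative of the inverse of a chart. -/
def chartFrame (ψ : OpenPartialHomeomorph M (EuclideanSpace ℝ (Fin d)))
    (u : EuclideanSpace ℝ (Fin d)) :
    EuclideanSpace ℝ (Fin d) →L[ℝ] TangentSpace (𝓡 d) (ψ.symm u) :=
  mfderiv (𝓡 d) (𝓡 d) ψ.symm u

/-- The local vector field with constant expression in a chart. -/
def constField (ψ : OpenPartialHomeomorph M (EuclideanSpace ℝ (Fin d)))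
    (v : EuclideanSpace ℝ (Fin d)) : ∀ x : M, TangentSpace (𝓡 d) x :=
  mpullback (𝓡 d) (𝓡 d) ψ (fun _ ↦ v)

variable {ψ : OpenPartialHomeomorph M (EuclideanSpace ℝ (Fin d))}
  (hψ : ψ ∈ IsManifold.maximalAtlas (𝓡 d) ∞ M)

include hψ

theorem mdifferentiable_of_mem_maximalAtlas : ψ.MDifferentiable (𝓡 d) (𝓡 d) :=
  ⟨(contMDiffOn_of_mem_maximalAtlas hψ).mdifferentiableOn (by simp),
    (contMDiffOn_symm_of_mem_maximalAtlas hψ).mdifferentiableOn (by simp)⟩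

theorem isInvertible_mfderiv_chart {q : M} (hq : q ∈ ψ.source) :
    (mfderiv (𝓡 d) (𝓡 d) ψ q).IsInvertible :=
  ⟨(mdifferentiable_of_mem_maximalAtlas hψ).mfderiv hq, rfl⟩

theorem isInvertible_mfderiv_chart_symm {u : EuclideanSpace ℝ (Fin d)} (hu : u ∈ ψ.target) :
    (mfderiv (𝓡 d) (𝓡 d) ψ.symm u).IsInvertible :=
  ⟨(mdifferentiable_of_mem_maximalAtlas hψ).symm.mfderiv (x := u) hu, rfl⟩

theorem chartFrame_chartField (X : ∀ x : M, TangentSpace (𝓡 d) x)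
    {u : EuclideanSpace ℝ (Fin d)} (hu : u ∈ ψ.target) :
    chartFrame ψ u (chartField ψ X u) = X (ψ.symm u) := by
  obtain ⟨e, he⟩ := isInvertible_mfderiv_chart_symm hψ hu
  rw [chartFrame, chartField, mpullback_apply, ← he, ContinuousLinearMap.inverse_equiv]
  exact e.apply_symm_apply _

theorem chartFrame_injective {u : EuclideanSpace ℝ (Fin d)} (hu : u ∈ ψ.target) :
    Injective (chartFrame ψ u) := by
  obtain ⟨e, he⟩ := isInvertible_mfderiv_chart_symm hψ hu
  rw [chartFrame, ← he]
  exact e.injective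

theorem chartFrame_surjective {u : EuclideanSpace ℝ (Fin d)} (hu : u ∈ ψ.target) :
    Surjective (chartFrame ψ u) := by
  obtain ⟨e, he⟩ := isInvertible_mfderiv_chart_symm hψ hu
  rw [chartFrame, ← he]
  exact e.surjective

theorem chartField_constField (v : EuclideanSpace ℝ (Fin d)) {u : EuclideanSpace ℝ (Fin d)}
    (hu : u ∈ ψ.target) : chartField ψ (constField ψ v) u = v := by
  obtain ⟨e, he⟩ := isInvertible_mfderiv_chart_symm hψ hu
  obtain ⟨e', he'⟩ := isInvertible_mfderiv_chart hψ (ψ.map_target hu)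
  have hc := (mdifferentiable_of_mem_maximalAtlas hψ).comp_symm_deriv hu
  have h0 : constField ψ v (ψ.symm u) = e'.symm v := by
    change (mfderiv (𝓡 d) (𝓡 d) ψ (ψ.symm u)).inverse v = _
    rw [← he', ContinuousLinearMap.inverse_equiv]
    rfl
  rw [chartField, mpullback_apply, h0, ← he, ContinuousLinearMap.inverse_equiv]
  rw [← he, ← he'] at hc
  have h1 := DFunLike.congr_fun hc (e.symm (e'.symm v))
  have h2 : e' (e (e.symm (e'.symm v))) = e.symm (e'.symm v) := h1
  have h3 : e (e.symm (e'.symm v)) = e'.symm v := e.apply_symm_apply _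
  have h4 : e' (e'.symm v) = v := e'.apply_symm_apply _
  rw [h3] at h2
  exact h2.symm.trans h4

theorem mfderiv_chart_chartFrame
    {u : EuclideanSpace ℝ (Fin d)} (hu : u ∈ ψ.target) (v : EuclideanSpace ℝ (Fin d)) :
    mfderiv (𝓡 d) (𝓡 d) ψ (ψ.symm u) (chartFrame ψ u v) = v :=
  DFunLike.congr_fun ((mdifferentiable_of_mem_maximalAtlas hψ).comp_symm_deriv hu) v

theorem chartField_apply_chart
    (X : ∀ x : M, TangentSpace (𝓡 d) x) {q : M} (hq : q ∈ ψ.source) :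
    chartField ψ X (ψ q) = mfderiv (𝓡 d) (𝓡 d) ψ q (X q) := by
  obtain ⟨u, hu, rfl⟩ : ∃ u ∈ ψ.target, ψ.symm u = q := ⟨ψ q, ψ.map_source hq, ψ.left_inv hq⟩
  refine (congrArg (chartField ψ X) (ψ.right_inv hu)).trans ?_
  refine Eq.trans ?_ (congrArg (mfderiv (𝓡 d) (𝓡 d) ψ (ψ.symm u)) (chartFrame_chartField hψ X hu))
  exact (mfderiv_chart_chartFrame hψ hu _).symm

theorem mfderiv_chart_injective
    {q : M} (hq : q ∈ ψ.source) : Injective (mfderiv (𝓡 d) (𝓡 d) ψ q) := by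
  obtain ⟨e, he⟩ := isInvertible_mfderiv_chart hψ hq
  rw [← he]
  exact e.injective

theorem mfderiv_chart_surjective
    {q : M} (hq : q ∈ ψ.source) : Surjective (mfderiv (𝓡 d) (𝓡 d) ψ q) := by
  obtain ⟨e, he⟩ := isInvertible_mfderiv_chart hψ hq
  rw [← he]
  exact e.surjective

theorem chartField_eq_zero_iff
    (X : ∀ x : M, TangentSpace (𝓡 d) x) {q : M} (hq : q ∈ ψ.source) :
    chartField ψ X (ψ q) = 0 ↔ X q = 0 := by
  rw [chartField_apply_chart hψ X hq]
  exact map_eq_zero_iff (mfderiv (𝓡 d) (𝓡 d) ψ q) (mfderiv_chart_injective hψ hq)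

variable [IsManifold (𝓡 d) ∞ M]

theorem contDiffOn_chartField {X : ∀ x : M, TangentSpace (𝓡 d) x}
    (hX : ContMDiffOn (𝓡 d) (𝓡 d).tangent ∞ (fun x ↦ (⟨x, X x⟩ : TangentBundle (𝓡 d) M)) ψ.source) :
    ContDiffOn ℝ ∞ (chartField ψ X) ψ.target := by
  intro u hu
  have h1 := ContMDiffAt.mpullback_vectorField_preimage (m := ∞) (n := ∞) (x₀ := u)
    (hX.contMDiffAt (ψ.open_source.mem_nhds (ψ.map_target hu)))
    (contMDiffAt_symm_of_mem_maximalAtlas hψ hu) (isInvertible_mfderiv_chart_symm hψ hu) (by simp)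
  have h2 := (contMDiff_snd_tangentBundle_modelSpace (n := ∞)
    (EuclideanSpace ℝ (Fin d)) (𝓡 d)).contMDiffAt.comp u h1
  exact (contMDiffAt_iff_contDiffAt.1 h2).contDiffWithinAt

theorem contMDiffOn_constField (v : EuclideanSpace ℝ (Fin d)) :
    ContMDiffOn (𝓡 d) (𝓡 d).tangent ∞
      (fun x ↦ (⟨x, constField ψ v x⟩ : TangentBundle (𝓡 d) M)) ψ.source := by
  intro q hq
  have hv : ContMDiffAt (𝓡 d) (𝓡 d).tangent ∞
      (fun u ↦ (⟨u, v⟩ : TangentBundle (𝓡 d) (EuclideanSpace ℝ (Fin d)))) (ψ q) :=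
    contMDiffAt_vectorSpace_iff_contDiffAt.2 contDiffAt_const
  exact (ContMDiffAt.mpullback_vectorField_preimage (m := ∞) (n := ∞) (x₀ := q) hv
    (contMDiffAt_of_mem_maximalAtlas hψ hq) (isInvertible_mfderiv_chart hψ hq)
    (by simp)).contMDiffWithinAt

/-- Naturality of the Lie bracket under pullback by the inverse chart. -/
theorem chartField_mlieBracket {X Y : ∀ x : M, TangentSpace (𝓡 d) x}
    {u : EuclideanSpace ℝ (Fin d)} (hu : u ∈ ψ.target)
    (hX : ContMDiffAt (𝓡 d) (𝓡 d).tangent ∞ (fun x ↦ (⟨x, X x⟩ : TangentBundle (𝓡 d) M)) (ψ.symm u))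
    (hY : ContMDiffAt (𝓡 d) (𝓡 d).tangent ∞ (fun x ↦ (⟨x, Y x⟩ : TangentBundle (𝓡 d) M))
      (ψ.symm u)) :
    chartField ψ (mlieBracket (𝓡 d) X Y) u =
      lieBracket ℝ (chartField ψ X) (chartField ψ Y) u := by
  have := isManifold_minSmoothness (d := d) (M := M) 2
  have h2 : minSmoothness ℝ 2 ≤ ∞ := by
    rw [minSmoothness_of_isRCLikeNormedField]
    exact WithTop.coe_le_coe.2 (le_top : (2 : ℕ∞) ≤ ⊤)
  have h := mpullback_mlieBracket (n := ∞) (I := 𝓡 d) (I' := 𝓡 d) (x₀ := u) (f := ψ.symm)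
    (hX.mdifferentiableAt (by simp)) (hY.mdifferentiableAt (by simp))
    (contMDiffAt_symm_of_mem_maximalAtlas hψ hu) h2
  rw [← mlieBracketWithin_univ (V := mpullback (𝓡 d) (𝓡 d) ψ.symm X),
    mlieBracketWithin_eq_lieBracketWithin] at h
  rw [← lieBracketWithin_univ]
  exact h

end Charts

/-! ### The metric and the Killing equation in a chart -/

section MetricInCharts

attribute [local instance] chartedSpaceEuclidean

variable {d : ℕ} {M : Type*} [TopologicalSpace M] [ChartedSpace (EuclideanSpace ℝ (Fin d)) M]
  [IsManifold (𝓡 d) ∞ M] (g : LorentzianMetric d M)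
  {ψ : OpenPartialHomeomorph M (EuclideanSpace ℝ (Fin d))}

/-- The expression of the metric in a chart. -/
def chartMetric (ψ : OpenPartialHomeomorph M (EuclideanSpace ℝ (Fin d)))
    (u : EuclideanSpace ℝ (Fin d)) :
    EuclideanSpace ℝ (Fin d) →L[ℝ] EuclideanSpace ℝ (Fin d) →L[ℝ] ℝ :=
  let B : EuclideanSpace ℝ (Fin d) →L[ℝ] EuclideanSpace ℝ (Fin d) →L[ℝ] ℝ := g.form (ψ.symm u)
  let A : EuclideanSpace ℝ (Fin d) →L[ℝ] EuclideanSpace ℝ (Fin d) := chartFrame ψ u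
  B.bilinearComp A A

theorem chartMetric_apply (u v w : EuclideanSpace ℝ (Fin d)) :
    chartMetric g ψ u v w = g.form (ψ.symm u) (chartFrame ψ u v) (chartFrame ψ u w) := rfl

theorem chartMetric_symm (u v w : EuclideanSpace ℝ (Fin d)) :
    chartMetric g ψ u v w = chartMetric g ψ u w v :=
  g.symm _ _ _

theorem LorentzianMetric.nondegenerate (x : M) (v : TangentSpace (𝓡 d) x)
    (hv : ∀ w, g.form x v w = 0) : v = 0 := by
  obtain ⟨t, ht, h⟩ := g.lorentzian x
  by_contra h0
  have := h v h0 (by rw [g.symm]; exact hv t)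
  rw [hv v] at this
  exact lt_irrefl _ this

theorem chartMetric_nondegenerate (hψ : ψ ∈ IsManifold.maximalAtlas (𝓡 d) ∞ M)
    {u : EuclideanSpace ℝ (Fin d)} (hu : u ∈ ψ.target)
    (v : EuclideanSpace ℝ (Fin d)) (hv : chartMetric g ψ u v = 0) : v = 0 := by
  have h : chartFrame ψ u v = 0 := by
    refine g.nondegenerate _ _ fun w ↦ ?_
    obtain ⟨w, rfl⟩ := chartFrame_surjective hψ hu w
    exact DFunLike.congr_fun hv w
  exact chartFrame_injective hψ hu (h.trans (map_zero _).symm)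

theorem chartMetric_chartField (hψ : ψ ∈ IsManifold.maximalAtlas (𝓡 d) ∞ M)
    {u : EuclideanSpace ℝ (Fin d)} (hu : u ∈ ψ.target) (X Y : ∀ x : M, TangentSpace (𝓡 d) x) :
    chartMetric g ψ u (chartField ψ X u) (chartField ψ Y u) =
      g.form (ψ.symm u) (X (ψ.symm u)) (Y (ψ.symm u)) := by
  rw [chartMetric_apply, chartFrame_chartField hψ X hu, chartFrame_chartField hψ Y hu]

theorem chartMetric_const (hψ : ψ ∈ IsManifold.maximalAtlas (𝓡 d) ∞ M)
    {u : EuclideanSpace ℝ (Fin d)} (hu : u ∈ ψ.target) (v w : EuclideanSpace ℝ (Fin d)) :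
    chartMetric g ψ u v w =
      g.form (ψ.symm u) (constField ψ v (ψ.symm u)) (constField ψ w (ψ.symm u)) := by
  rw [← chartMetric_chartField g hψ hu, chartField_constField hψ v hu,
    chartField_constField hψ w hu]

theorem contDiffOn_chartMetric (hψ : ψ ∈ IsManifold.maximalAtlas (𝓡 d) ∞ M) :
    ContDiffOn ℝ ∞ (chartMetric g ψ) ψ.target := by
  rw [contDiffOn_clm_apply]
  intro v
  rw [contDiffOn_clm_apply]
  intro w
  have h1 := (g.contMDiffOn_form (contMDiffOn_constField hψ v) (contMDiffOn_constField hψ w)).comp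
    (contMDiffOn_symm_of_mem_maximalAtlas hψ) (fun u hu ↦ ψ.map_target hu)
  refine (contMDiffOn_iff_contDiffOn.1 h1).congr fun u hu ↦ ?_
  exact chartMetric_const g hψ hu v w

/-- A Killing field is a Killing field in every chart. -/
theorem isKillingOn_chartField (hψ : ψ ∈ IsManifold.maximalAtlas (𝓡 d) ∞ M)
    {K : SmoothVectorField d M} (hK : g.IsKilling K) :
    IsKillingOn (chartMetric g ψ) ψ.target (chartField ψ K) where
  contDiffOn := contDiffOn_chartField hψ K.contMDiff.contMDiffOn
  killing u hu v w := by
    have hq := ψ.map_target hu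
    have sv := contMDiffOn_constField hψ v
    have sw := contMDiffOn_constField hψ w
    have nq := ψ.open_source.mem_nhds hq
    have h := hK ψ.source ψ.open_source _ _ sv sw _ hq
    -- For a constant field the bracket reduces to $-DK\,z$, which turns the invariant Killing
    -- equation into the coordinate one.
    have br (z : EuclideanSpace ℝ (Fin d)) :
        chartField ψ (mlieBracket (𝓡 d) K (constField ψ z)) u =
          - fderiv ℝ (chartField ψ K) u z := by
      rw [chartField_mlieBracket hψ hu (K.contMDiff _)
        ((contMDiffOn_constField hψ z).contMDiffAt nq)]
      have e : chartField ψ (constField ψ z) =ᶠ[𝓝 u] fun _ ↦ z :=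
        eventually_of_mem (ψ.open_target.mem_nhds hu) fun y hy ↦ chartField_constField hψ z hy
      simp [lieBracket, e.fderiv_eq, e.self_of_nhds]
    rw [← chartMetric_chartField g hψ hu, ← chartMetric_chartField g hψ hu, br, br,
      chartField_constField hψ v hu, chartField_constField hψ w hu] at h
    have hd : MDifferentiableAt (𝓡 d) 𝓘(ℝ, ℝ)
        (fun y ↦ g.form y (constField ψ v y) (constField ψ w y)) (ψ.symm u) :=
      ((g.contMDiffOn_form sv sw).contMDiffAt nq).mdifferentiableAt (by simp)
    have hc := mvfderiv_comp_apply (I := 𝓡 d) (I' := 𝓡 d) u hd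
      ((contMDiffAt_symm_of_mem_maximalAtlas hψ hu).mdifferentiableAt (by simp)) (chartField ψ K u)
    have hf : mfderiv (𝓡 d) (𝓡 d) ψ.symm u (chartField ψ K u) = K (ψ.symm u) :=
      chartFrame_chartField hψ K hu
    rw [hf, h] at hc
    have e : (fun y ↦ g.form y (constField ψ v y) (constField ψ w y)) ∘ ψ.symm =ᶠ[𝓝 u]
        fun y ↦ chartMetric g ψ y v w :=
      eventually_of_mem (ψ.open_target.mem_nhds hu) fun y hy ↦ (chartMetric_const g hψ hy v w).symm
    have hm : mvfderiv (𝓡 d) ((fun y ↦ g.form y (constField ψ v y) (constField ψ w y)) ∘ ψ.symm) u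
        (chartField ψ K u) = fderiv ℝ (fun y ↦ chartMetric g ψ y v w) u (chartField ψ K u) := by
      rw [← e.fderiv_eq, ← mfderiv_eq_fderiv]
      rfl
    have hG := (((contDiffOn_chartMetric g hψ).hasFDerivAt_of_isOpen ψ.open_target hu).clm_apply
      (hasFDerivAt_const v u)).clm_apply (hasFDerivAt_const w u)
    rw [hm, hG.fderiv] at hc
    simp at hc
    linarith

end MetricInCharts

/-! ### Killing fields are determined by their first-order Taylor polynomial at a point -/

section Uniqueness

attribute [local instance] chartedSpaceEuclidean

variable {d : ℕ} {M : Type*} [TopologicalSpace M] [ChartedSpace (EuclideanSpace ℝ (Fin d)) M]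
  [IsManifold (𝓡 d) ∞ M] (g : LorentzianMetric d M)
  {ψ : OpenPartialHomeomorph M (EuclideanSpace ℝ (Fin d))}

theorem chartMetric_apply_chart (hψ : ψ ∈ IsManifold.maximalAtlas (𝓡 d) ∞ M)
    {q : M} (hq : q ∈ ψ.source) (v w : TangentSpace (𝓡 d) q) :
    chartMetric g ψ (ψ q) (mfderiv (𝓡 d) (𝓡 d) ψ q v) (mfderiv (𝓡 d) (𝓡 d) ψ q w) =
      g.form q v w := by
  obtain ⟨u, hu, rfl⟩ : ∃ u ∈ ψ.target, ψ.symm u = q := ⟨ψ q, ψ.map_source hq, ψ.left_inv hq⟩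
  obtain ⟨v, rfl⟩ := chartFrame_surjective hψ hu v
  obtain ⟨w, rfl⟩ := chartFrame_surjective hψ hu w
  rw [mfderiv_chart_chartFrame hψ hu, mfderiv_chart_chartFrame hψ hu, ← chartMetric_apply]
  exact congrArg (fun y ↦ chartMetric g ψ y v w) (ψ.right_inv hu)

namespace LorentzianMetric

/-- Around every point, Killing fields are determined by their Taylor polynomial at any point. -/
theorem exists_nhds_unique (hψ : ψ ∈ IsManifold.maximalAtlas (𝓡 d) ∞ M) {q : M}
    (hq : q ∈ ψ.source) : ∃ O : Set M, IsOpen O ∧ q ∈ O ∧ O ⊆ ψ.source ∧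
      ∀ K : SmoothVectorField d M, g.IsKilling K → ∀ a ∈ O, chartField ψ K (ψ a) = 0 →
        fderiv ℝ (chartField ψ K) (ψ a) = 0 → ∀ y ∈ O, K y = 0 := by
  obtain ⟨r, hr, hrU, h⟩ := IsKillingOn.exists_ball_unique ψ.open_target
    (contDiffOn_chartMetric g hψ) (fun x _ ↦ chartMetric_symm g x) (ψ.map_source hq)
    (chartMetric_nondegenerate g hψ (ψ.map_source hq))
  refine ⟨ψ.source ∩ ψ ⁻¹' Metric.ball (ψ q) r, ψ.isOpen_inter_preimage Metric.isOpen_ball,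
    ⟨hq, Metric.mem_ball_self hr⟩, inter_subset_left, fun K hK a ha h0 h1 y hy ↦ ?_⟩
  exact (chartField_eq_zero_iff hψ K hy.1).1
    (h _ (isKillingOn_chartField g hψ hK) (ψ a) ha.2 h0 h1 hy.2)

/-- A Killing field on a connected manifold vanishes if its first-order Taylor polynomial vanishes
at some point. -/
theorem eq_zero_of_jet_eq_zero [ConnectedSpace M] (hψ : ψ ∈ IsManifold.maximalAtlas (𝓡 d) ∞ M)
    {K : SmoothVectorField d M} (hK : g.IsKilling K) {q : M} (hq : q ∈ ψ.source)
    (h0 : chartField ψ K (ψ q) = 0) (h1 : fderiv ℝ (chartField ψ K) (ψ q) = 0) : K = 0 := by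
  set A : Set M := {y | ∀ᶠ z in 𝓝 y, K z = 0}
  have hA : IsOpen A := isOpen_setOfPred_eventually_nhds
  have hne : A.Nonempty := by
    obtain ⟨O, hO, hqO, -, h⟩ := g.exists_nhds_unique hψ hq
    exact ⟨q, eventually_of_mem (hO.mem_nhds hqO) (h K hK q hqO h0 h1)⟩
  have hcl : IsClosed A := by
    -- A uniqueness neighbourhood of a limit point `y` meets `A` at some `a`, where the jet of `K`
    -- is zero. Uniqueness from an arbitrary point of the neighbourhood, not only its centre, is
    -- what is needed.
    refine isClosed_of_closure_subset fun y hy ↦ ?_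
    have hχ : chartAt (EuclideanSpace ℝ (Fin d)) y ∈ IsManifold.maximalAtlas (𝓡 d) ∞ M :=
      IsManifold.chart_mem_maximalAtlas y
    set χ := chartAt (EuclideanSpace ℝ (Fin d)) y
    obtain ⟨O, hO, hyO, hOs, h⟩ := g.exists_nhds_unique hχ (mem_chart_source _ y)
    obtain ⟨a, haO, haA⟩ := mem_closure_iff.1 hy O hO hyO
    have haS := hOs haO
    have e : chartField χ K =ᶠ[𝓝 (χ a)] fun _ ↦ 0 := by
      have t : Tendsto χ.symm (𝓝 (χ a)) (𝓝 a) := by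
        simpa [χ.left_inv haS] using (χ.continuousAt_symm (χ.map_source haS)).tendsto
      filter_upwards [t.eventually haA, χ.open_target.mem_nhds (χ.map_source haS)] with z hz hzt
      have := (chartField_eq_zero_iff hχ K (χ.map_target hzt)).2 hz
      rwa [χ.right_inv hzt] at this
    exact eventually_of_mem (hO.mem_nhds hyO)
      (h K hK a haO e.self_of_nhds (by rw [e.fderiv_eq]; simp))
  have hu : A = univ := IsClopen.eq_univ ⟨hcl, hA⟩ hne
  ext y : 1
  have : y ∈ A := hu ▸ mem_univ y
  exact this.self_of_nhds

/-- Orthogonal null vectors are proportional. -/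
theorem exists_smul_eq_of_null {x : M} {v w : TangentSpace (𝓡 d) x} (hv : v ≠ 0)
    (hvv : g.form x v v = 0) (hww : g.form x w w = 0) (hvw : g.form x v w = 0) :
    ∃ c : ℝ, w = c • v := by
  obtain ⟨t, -, h⟩ := g.lorentzian x
  have htv : g.form x t v ≠ 0 := fun h0 ↦ (h v hv h0).ne' hvv
  refine ⟨g.form x t w / g.form x t v, ?_⟩
  by_contra hne
  -- This combination is orthogonal to the timelike `t`, hence has positive square if nonzero; but
  -- it is null.
  have hpos := h (w - (g.form x t w / g.form x t v) • v) (sub_ne_zero.2 hne) (by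
    simp only [map_sub, map_smul, smul_eq_mul]
    field_simp
    ring)
  rw [g.symm x v w] at hvw
  simp only [map_sub, map_smul, sub_apply, smul_apply, smul_eq_mul, hvv, hww, hvw,
    g.symm x v w] at hpos
  simp at hpos

end LorentzianMetric

end Uniqueness

/-! ### Slice charts of a hypersurface -/

section Slices

attribute [local instance] chartedSpaceEuclidean

variable {n : ℕ} {M : Type*} [TopologicalSpace M]
  [ChartedSpace (EuclideanSpace ℝ (Fin (n + 1))) M]
  {N : Type*} [TopologicalSpace N] [ChartedSpace (EuclideanSpace ℝ (Fin n)) N] {ι : N → M}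

/-- The chart `ψ` flattens the hypersurface near `ι p` to the hyperplane with direction `V`. -/
structure IsSliceChart (ι : N → M) (p : N)
    (ψ : OpenPartialHomeomorph M (EuclideanSpace ℝ (Fin (n + 1))))
    (V : Submodule ℝ (EuclideanSpace ℝ (Fin (n + 1)))) : Prop where
  mem_maximalAtlas : ψ ∈ IsManifold.maximalAtlas (𝓡 (n + 1)) ∞ M
  mem_source : ι p ∈ ψ.source
  exists_complement : ∃ e, ∀ z, ∃ v ∈ V, ∃ c : ℝ, z = v + c • e
  eventually_mem : ∀ O ∈ 𝓝 p, ∀ᶠ y in 𝓝 (ψ (ι p)), y - ψ (ι p) ∈ V →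
    ∃ p' ∈ O, ι p' ∈ ψ.source ∧ ψ (ι p') = y ∧ ∀ w : TangentSpace (𝓡 (n + 1)) (ι p'),
      w ∈ hypersurfaceTangent n ι p' ↔ mfderiv (𝓡 (n + 1)) (𝓡 (n + 1)) ψ (ι p') w ∈ V

/-- The normal form of an immersion, with a one-dimensional complement by counting dimensions. Only
points of the hyperplane are claimed to come from points of `N` near `p`; other sheets may cross the
chart, so no embedding is needed. -/
theorem IsHypersurface.exists_sliceChart (hι : IsHypersurface n ι) (p : N) :
    ∃ (ψ : OpenPartialHomeomorph M (EuclideanSpace ℝ (Fin (n + 1)))) (V : Submodule ℝ _),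
      IsSliceChart ι p ψ V := by
  have him := hι.immersion
  have hp := him.isImmersionAt p
  set φ := hp.domChart
  set ψ := hp.codChart
  set E := hp.equiv
  have hφ : φ ∈ IsManifold.maximalAtlas (𝓡 n) ∞ N := hp.domChart_mem_maximalAtlas
  have hψ : ψ ∈ IsManifold.maximalAtlas (𝓡 (n + 1)) ∞ M := hp.codChart_mem_maximalAtlas
  have hpφ : p ∈ φ.source := hp.mem_domChart_source
  have hsrc : ∀ q ∈ φ.source, ι q ∈ ψ.source := hp.source_subset_preimage_source
  have hw : ∀ a ∈ φ.target, ψ (ι (φ.symm a)) = E (a, 0) := by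
    intro a ha
    have h1 : a ∈ (hp.domChart.extend (𝓡 n)).target := by simpa using ha
    simpa using hp.writtenInCharts h1
  have hw' : ∀ q ∈ φ.source, ψ (ι q) = E (φ q, 0) := by
    intro q hq
    rw [← hw _ (φ.map_source hq), φ.left_inv hq]
  let L : EuclideanSpace ℝ (Fin n) →L[ℝ] EuclideanSpace ℝ (Fin (n + 1)) :=
    E.toContinuousLinearMap.comp
      (ContinuousLinearMap.inl ℝ (EuclideanSpace ℝ (Fin n)) hp.complement)
  have hL : ∀ a, L a = E (a, 0) := fun a ↦ rfl
  refine ⟨ψ, LinearMap.range L.toLinearMap, hψ, hp.mem_codChart_source, ?_, fun O hO ↦ ?_⟩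
  · have : FiniteDimensional ℝ (EuclideanSpace ℝ (Fin n) × hp.complement) :=
      E.symm.toLinearEquiv.finiteDimensional
    have : FiniteDimensional ℝ hp.complement :=
      FiniteDimensional.of_injective (LinearMap.inr ℝ (EuclideanSpace ℝ (Fin n)) hp.complement)
        LinearMap.inr_injective
    have hf : Module.finrank ℝ hp.complement = 1 := by
      have := E.toLinearEquiv.finrank_eq
      rw [Module.finrank_prod, finrank_euclideanSpace_fin, finrank_euclideanSpace_fin] at this
      omega
    obtain ⟨f, -, hf⟩ := finrank_eq_one_iff'.1 hf
    refine ⟨E (0, f), fun z ↦ ?_⟩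
    obtain ⟨c, hc⟩ := hf (E.symm z).2
    refine ⟨L (E.symm z).1, ⟨_, rfl⟩, c, ?_⟩
    rw [hL, ← map_smul, ← map_add]
    simp [hc]
  · have hy0 : ψ (ι p) = E (φ p, 0) := hw' p hpφ
    have t : Tendsto (fun y ↦ (E.symm y).1) (𝓝 (ψ (ι p))) (𝓝 (φ p)) := by
      have : Continuous (fun y ↦ (E.symm y).1) := by fun_prop
      simpa [hy0] using this.tendsto (ψ (ι p))
    have hO' : φ.symm ⁻¹' O ∈ 𝓝 (φ p) :=
      (φ.continuousAt_symm (φ.map_source hpφ)).preimage_mem_nhds (by rwa [φ.left_inv hpφ])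
    filter_upwards [t.eventually hO', t.eventually (φ.open_target.mem_nhds (φ.map_source hpφ))]
      with y hyO hyt hyV
    obtain ⟨b, hb⟩ := hyV
    have hyE : E ((E.symm y).1, 0) = y := by
      have h1 : y = E (φ p + b, 0) := by
        have h2 : y = ψ (ι p) + L b := by rw [← sub_eq_iff_eq_add']; exact hb.symm
        rw [h2, hy0, hL, ← map_add]
        simp
      conv_lhs => rw [h1]
      rw [h1]
      simp
    set p' := φ.symm (E.symm y).1
    have hp' : p' ∈ φ.source := φ.map_target hyt
    refine ⟨p', hyO, hsrc _ hp', (hw _ hyt).trans hyE, fun w ↦ ?_⟩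
    have dι : MDifferentiableAt (𝓡 n) (𝓡 (n + 1)) ι p' :=
      (him.contMDiff p').mdifferentiableAt (by simp)
    have dψ := (mdifferentiable_of_mem_maximalAtlas hψ).mdifferentiableAt (hsrc _ hp')
    have dφ := (mdifferentiable_of_mem_maximalAtlas hφ).mdifferentiableAt hp'
    -- Differentiating $\psi\circ\iota = L\circ\varphi$. As $D\varphi$ is onto and $D\psi$ is
    -- injective, $D\psi$ identifies the tangent space with the range of `L`.
    have hcomp : ∀ z : TangentSpace (𝓡 n) p',
        mfderiv (𝓡 (n + 1)) (𝓡 (n + 1)) ψ (ι p') (mfderiv (𝓡 n) (𝓡 (n + 1)) ι p' z) =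
          L (mfderiv (𝓡 n) (𝓡 n) φ p' z) := by
      intro z
      have e : ψ ∘ ι =ᶠ[𝓝 p'] L ∘ φ :=
        eventually_of_mem (φ.open_source.mem_nhds hp') fun q hq ↦ hw' q hq
      have h1 := mfderiv_comp_apply p' dψ dι z
      have h2 := mfderiv_comp_apply (I'' := 𝓡 (n + 1)) p' (L.mdifferentiableAt (x := φ p')) dφ z
      rw [ContinuousLinearMap.mfderiv_eq] at h2
      rw [← h1]
      exact (DFunLike.congr_fun (e.mfderiv_eq (I := 𝓡 n) (I' := 𝓡 (n + 1))) z).trans h2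
    constructor
    · rintro ⟨z, rfl⟩
      exact ⟨_, (hcomp z).symm⟩
    · rintro ⟨b', hb'⟩
      obtain ⟨z, hz⟩ := mfderiv_chart_surjective hφ hp' b'
      refine ⟨z, mfderiv_chart_injective hψ (hsrc _ hp') ?_⟩
      refine (hcomp z).trans ?_
      rw [hz]
      exact hb'

/-- Injectivity of `ι` enters here: the point of `N` lying over the centre of the chart must be `p`
itself. -/
theorem IsSliceChart.mem_tangent_iff {p : N}
    {ψ : OpenPartialHomeomorph M (EuclideanSpace ℝ (Fin (n + 1)))}
    {V : Submodule ℝ (EuclideanSpace ℝ (Fin (n + 1)))} (h : IsSliceChart ι p ψ V) (hι : Injective ι)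
    (w : TangentSpace (𝓡 (n + 1)) (ι p)) :
    w ∈ hypersurfaceTangent n ι p ↔ mfderiv (𝓡 (n + 1)) (𝓡 (n + 1)) ψ (ι p) w ∈ V := by
  obtain ⟨p', -, hs, he, ht⟩ := (h.eventually_mem univ univ_mem).self_of_nhds (by simp)
  obtain rfl : p' = p := hι (ψ.injOn hs h.mem_source he)
  exact ht w

end Slices

/-! ### Killing fields normal to a null hypersurface -/

section NormalKillingFields

variable {n : ℕ} {M : Type*} [TopologicalSpace M]
  [ChartedSpace (EuclideanSpace ℝ (Fin (n + 1))) M] [IsManifold (𝓡 (n + 1)) ∞ M]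
  {N : Type*} [TopologicalSpace N] [ChartedSpace (EuclideanSpace ℝ (Fin n)) N] {ι : N → M}

/-- The vector field `X` is tangent to the hypersurface. -/
def IsTangentTo (ι : N → M) (X : SmoothVectorField (n + 1) M) : Prop :=
  ∀ p : N, X (ι p) ∈ hypersurfaceTangent n ι p

/-- The vector field `K` is normal to the hypersurface. -/
def LorentzianMetric.IsNormalTo (g : LorentzianMetric (n + 1) M) (ι : N → M)
    (K : SmoothVectorField (n + 1) M) : Prop :=
  ∀ p : N, ∀ w ∈ hypersurfaceTangent n ι p, g.form (ι p) (K (ι p)) w = 0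

namespace IsSliceChart

variable {p : N} {ψ : OpenPartialHomeomorph M (EuclideanSpace ℝ (Fin (n + 1)))}
  {V : Submodule ℝ (EuclideanSpace ℝ (Fin (n + 1)))} (h : IsSliceChart ι p ψ V)

include h

theorem chartField_mem {X : SmoothVectorField (n + 1) M} (hX : IsTangentTo ι X) :
    ∀ᶠ y in 𝓝 (ψ (ι p)), y - ψ (ι p) ∈ V → chartField ψ X y ∈ V := by
  filter_upwards [h.eventually_mem univ univ_mem] with y hy hyV
  obtain ⟨p', -, hs, rfl, ht⟩ := hy hyV
  rw [chartField_apply_chart h.mem_maximalAtlas X hs]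
  exact (ht _).1 (hX p')

theorem chartMetric_chartField_eq_zero {g : LorentzianMetric (n + 1) M}
    {K : SmoothVectorField (n + 1) M} (hK : g.IsNormalTo ι K) :
    ∀ᶠ y in 𝓝 (ψ (ι p)), y - ψ (ι p) ∈ V →
      ∀ v ∈ V, chartMetric g ψ y (chartField ψ K y) v = 0 := by
  filter_upwards [h.eventually_mem univ univ_mem] with y hy hyV v hv
  obtain ⟨p', -, hs, rfl, ht⟩ := hy hyV
  obtain ⟨w, rfl⟩ := mfderiv_chart_surjective h.mem_maximalAtlas hs v
  rw [chartField_apply_chart h.mem_maximalAtlas K hs]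
  exact (chartMetric_apply_chart g h.mem_maximalAtlas hs _ _).trans (hK p' w ((ht w).2 hv))

end IsSliceChart

variable (g : LorentzianMetric (n + 1) M)

namespace LorentzianMetric

variable {g}

/-- The bracket of a tangent Killing field with a normal vector field is normal. -/
theorem IsNormalTo.lie (hι : IsHypersurface n ι) {X K : SmoothVectorField (n + 1) M}
    (hX : g.IsKilling X) (hXt : IsTangentTo ι X) (hK : g.IsNormalTo ι K) :
    g.IsNormalTo ι ⁅X, K⁆ := by
  intro p w hw
  obtain ⟨ψ, V, h⟩ := hι.exists_sliceChart p
  have hψ := h.mem_maximalAtlas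
  have hu := ψ.map_source h.mem_source
  have key := (isKillingOn_chartField g hψ hX).lieBracket_normal
    (contDiffOn_chartField hψ K.contMDiff.contMDiffOn) ψ.open_target (contDiffOn_chartMetric g hψ)
    hu (h.chartMetric_chartField_eq_zero hK) (h.chartField_mem hXt)
    ((h.mem_tangent_iff hι.injective w).1 hw)
  rw [← chartField_mlieBracket hψ hu (X.contMDiff _) (K.contMDiff _),
    chartField_apply_chart hψ _ h.mem_source] at key
  exact (chartMetric_apply_chart g hψ h.mem_source _ _).symm.trans key

/-- A Killing field vanishing on a nonempty open subset of a hypersurface vanishes. -/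
theorem IsKilling.eq_zero_of_eqOn [ConnectedSpace M] (hι : IsHypersurface n ι)
    {K : SmoothVectorField (n + 1) M} (hK : g.IsKilling K) {O : Set N} (hO : IsOpen O)
    (hne : O.Nonempty) (h0 : ∀ p ∈ O, K (ι p) = 0) : K = 0 := by
  obtain ⟨p, hp⟩ := hne
  obtain ⟨ψ, V, h⟩ := hι.exists_sliceChart p
  have hψ := h.mem_maximalAtlas
  have hu := ψ.map_source h.mem_source
  obtain ⟨e, he⟩ := h.exists_complement
  have ev : ∀ᶠ y in 𝓝 (ψ (ι p)), y - ψ (ι p) ∈ V → chartField ψ K y = 0 := by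
    filter_upwards [h.eventually_mem O (hO.mem_nhds hp)] with y hy hyV
    obtain ⟨p', hp', hs, rfl, -⟩ := hy hyV
    exact (chartField_eq_zero_iff hψ K hs).2 (h0 p' hp')
  obtain ⟨h1, h2⟩ := (isKillingOn_chartField g hψ hK).jet_eq_zero ψ.open_target
    (fun x _ ↦ chartMetric_symm g x) hu (chartMetric_nondegenerate g hψ hu) he ev
  exact g.eq_zero_of_jet_eq_zero hψ hK h.mem_source h1 h2

/-- If `L` is a null normal Killing field, then at each point of the hypersurface at which `L` does
not vanish `(ad L)²` is a multiple of `ad L` on normal Killing fields. -/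
theorem IsKilling.exists_ad_sq_eq (hι : IsHypersurface n ι) {L : SmoothVectorField (n + 1) M}
    (hL : g.IsKilling L) (hLn : g.IsNormalTo ι L)
    (hnull : ∀ p, g.form (ι p) (L (ι p)) (L (ι p)) = 0) {p : N} (hLp : L (ι p) ≠ 0) :
    ∃ c : ℝ, ∀ K : SmoothVectorField (n + 1) M, g.IsKilling K → ∀ α β γ : ℝ,
      K (ι p) = α • L (ι p) → ⁅L, K⁆ (ι p) = β • L (ι p) → ⁅L, ⁅L, K⁆⁆ (ι p) = γ • L (ι p) →
      γ = c * β := by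
  obtain ⟨ψ, V, h⟩ := hι.exists_sliceChart p
  have hψ := h.mem_maximalAtlas
  have hs := h.mem_source
  have hu := ψ.map_source hs
  obtain ⟨e, he⟩ := h.exists_complement
  have ev : ∀ᶠ y in 𝓝 (ψ (ι p)), y - ψ (ι p) ∈ V →
      chartMetric g ψ y (chartField ψ L y) (chartField ψ L y) = 0 := by
    filter_upwards [h.eventually_mem univ univ_mem] with y hy hyV
    obtain ⟨p', -, hs', rfl, -⟩ := hy hyV
    rw [chartField_apply_chart hψ L hs']
    exact (chartMetric_apply_chart g hψ hs' _ _).trans (hnull p')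
  obtain ⟨c, hc⟩ := (isKillingOn_chartField g hψ hL).exists_ad_sq_eq ψ.open_target
    (contDiffOn_chartMetric g hψ) (fun x _ ↦ chartMetric_symm g x) hu
    (chartMetric_nondegenerate g hψ hu) he
    (fun h0 ↦ hLp ((chartField_eq_zero_iff hψ L hs).1 h0))
    ((h.chartMetric_chartField_eq_zero hLn).self_of_nhds (by simp)) ev
  have sm : ∀ (X : SmoothVectorField (n + 1) M) (a : ℝ), X (ι p) = a • L (ι p) →
      chartField ψ X (ψ (ι p)) = a • chartField ψ L (ψ (ι p)) := by
    intro X a hX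
    rw [chartField_apply_chart hψ X hs, chartField_apply_chart hψ L hs, hX]
    exact map_smul _ a _
  have br : ∀ X : SmoothVectorField (n + 1) M, ∀ y ∈ ψ.target,
      chartField ψ (⁅L, X⁆ : SmoothVectorField (n + 1) M) y =
        lieBracket ℝ (chartField ψ L) (chartField ψ X) y := fun X y hy ↦
    chartField_mlieBracket hψ hy (L.contMDiff _) (X.contMDiff _)
  refine ⟨c, fun K hK α β γ hα hβ hγ ↦ ?_⟩
  have hLK : g.IsKilling ⁅L, K⁆ := g.killingAlgebra.lie_mem hL hK
  refine hc _ _ (isKillingOn_chartField g hψ hK) (isKillingOn_chartField g hψ hLK) (br K) α β γ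
    (sm K α hα) (sm _ β hβ) ?_
  rw [← br _ _ hu]
  exact sm _ γ hγ

end LorentzianMetric

/-- The bracket of two vector fields that are multiples of `L` at `x`. -/
theorem SmoothVectorField.lie_apply_of_smul {d : ℕ} {M : Type*} [TopologicalSpace M]
    [ChartedSpace (EuclideanSpace ℝ (Fin d)) M] [IsManifold (𝓡 d) ∞ M]
    {L K₁ K₂ : SmoothVectorField d M} {x : M} {α₁ α₂ : ℝ}
    (h₁ : K₁ x = α₁ • L x) (h₂ : K₂ x = α₂ • L x) :
    ⁅K₁, K₂⁆ x = α₁ • ⁅L, K₂⁆ x - α₂ • ⁅L, K₁⁆ x := by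
  -- Two fields vanishing at `x` have bracket zero there. The coefficients are constants, so
  -- expanding produces no derivatives of them.
  have h : ⁅K₁ - α₁ • L, K₂ - α₂ • L⁆ x = 0 := by
    rw [SmoothVectorField.lie_apply, ← mlieBracketWithin_univ]
    exact mlieBracketWithin_eq_zero_of_eq_zero (by simp [h₁]) (by simp [h₂])
  have e : ⁅K₁ - α₁ • L, K₂ - α₂ • L⁆ = ⁅K₁, K₂⁆ - (α₁ • ⁅L, K₂⁆ - α₂ • ⁅L, K₁⁆) := by
    rw [sub_lie, lie_sub, lie_sub, lie_smul, smul_lie, smul_lie, lie_smul, lie_self,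
      ← lie_skew L K₁]
    simp only [smul_neg, smul_zero]
    abel
  rw [e] at h
  exact sub_eq_zero.1 h

/-- The derived ideal is spanned by single brackets, so bilinearity reduces the vanishing of the
second derived ideal to brackets of brackets. -/
theorem LieIdeal.isSolvable_of_lie_lie_eq_zero {R A : Type*} [CommRing R] [LieRing A]
    [LieAlgebra R A] (I : LieIdeal R A)
    (h : ∀ a ∈ I, ∀ b ∈ I, ∀ c ∈ I, ∀ d ∈ I, ⁅⁅a, b⁆, ⁅c, d⁆⁆ = 0) : LieAlgebra.IsSolvable I := by
  refine (LieAlgebra.isSolvable_iff R I).2 ⟨2, ?_⟩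
  rw [LieAlgebra.derivedSeries_def, LieAlgebra.derivedSeriesOfIdeal_succ,
    LieSubmodule.lie_eq_bot_iff]
  intro x hx y hy
  have hs := LieAlgebra.coe_derivedSeries_one_eq (R := R) (L := I)
  replace hx : x ∈ Submodule.span R {z : I | ∃ a b : I, ⁅a, b⁆ = z} := hs ▸ hx
  replace hy : y ∈ Submodule.span R {z : I | ∃ a b : I, ⁅a, b⁆ = z} := hs ▸ hy
  induction hx, hy using Submodule.span_induction₂ with
  | mem_mem x y hx hy =>
    obtain ⟨a, b, rfl⟩ := hx
    obtain ⟨c, d, rfl⟩ := hy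
    exact Subtype.ext (h a a.2 b b.2 c c.2 d d.2)
  | zero_left y hy => simp
  | zero_right x hx => simp
  | add_left x y z hx hy hz h1 h2 => simp [h1, h2]
  | add_right x y z hx hy hz h1 h2 => simp [h1, h2]
  | smul_left r x y hx hy h1 => simp [h1]
  | smul_right r x y hx hy h1 => simp [h1]

/-! ### The ideal of normal Killing fields -/

namespace LorentzianMetric

/-- The ideal of Killing fields that are normal to a hypersurface invariant under the Killing
algebra. -/
def normalIdeal (hι : IsHypersurface n ι) (hinv : g.IsKillingInvariant ι) :
    LieIdeal ℝ g.killingAlgebra where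
  carrier := {K | g.IsNormalTo ι (K : SmoothVectorField (n + 1) M)}
  zero_mem' p w _ := by simp
  add_mem' := by
    intro K L hK hL p w hw
    simp [hK p w hw, hL p w hw]
  smul_mem' := by
    intro c K hK p w hw
    simp [hK p w hw]
  lie_mem := by
    intro X K hK
    exact IsNormalTo.lie hι X.2 (hinv X X.2) hK

variable {g}

/-- On a null hypersurface, the normal tangent vectors are the null tangent vectors. -/
theorem IsNullHypersurface.normal_of_null (hN : g.IsNullHypersurface ι) {p : N}
    {w : TangentSpace (𝓡 (n + 1)) (ι p)} (hw : w ∈ hypersurfaceTangent n ι p)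
    (hww : g.form (ι p) w w = 0) : ∀ z ∈ hypersurfaceTangent n ι p, g.form (ι p) w z = 0 := by
  obtain ⟨v, hv, hv0, hvn⟩ := hN.2 p
  obtain ⟨c, rfl⟩ := g.exists_smul_eq_of_null hv0 (hvn v hv) hww (hvn w hw)
  intro z hz
  simp [hvn z hz]

/-- Normal and tangent means null, and conversely on a null hypersurface. For nonzero `K` the
nonvanishing set is open by continuity, and dense since a Killing field zero on an open piece of the
hypersurface is zero. -/
theorem coe_normalIdeal [ConnectedSpace M] (hN : g.IsNullHypersurface ι)
    (hinv : g.IsKillingInvariant ι) :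
    (g.normalIdeal hN.1 hinv : Set g.killingAlgebra) = g.generators ι := by
  ext K
  refine ⟨fun hK ↦ ?_, ?_⟩
  · by_cases h0 : K = 0
    · exact Or.inr h0
    refine Or.inl ⟨fun p ↦ hK p _ (hinv K K.2 p), {p | (K : SmoothVectorField (n + 1) M) (ι p) ≠ 0},
      ?_, ?_, fun p hp ↦ ⟨hinv K K.2 p, hp⟩⟩
    · rw [isOpen_iff_mem_nhds]
      intro p hp
      have hψ : chartAt (EuclideanSpace ℝ (Fin (n + 1))) (ι p) ∈
        IsManifold.maximalAtlas (𝓡 (n + 1)) ∞ M := IsManifold.chart_mem_maximalAtlas _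
      set ψ := chartAt (EuclideanSpace ℝ (Fin (n + 1))) (ι p)
      have hs : ι p ∈ ψ.source := mem_chart_source _ _
      have cι : ContinuousAt ι p := hN.1.immersion.contMDiff.continuous.continuousAt
      have c1 : ContinuousAt (chartField ψ (K : SmoothVectorField (n + 1) M)) (ψ (ι p)) :=
        ((isKillingOn_chartField g hψ K.2).contDiffOn.contDiffAt
          (ψ.open_target.mem_nhds (ψ.map_source hs))).continuousAt
      have c2 : ContinuousAt (fun q ↦ chartField ψ (K : SmoothVectorField (n + 1) M) (ψ (ι q))) p :=
        ContinuousAt.comp (f := fun q ↦ ψ (ι q)) c1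
          (ContinuousAt.comp (f := ι) (ψ.continuousAt hs) cι)
      filter_upwards [c2.eventually_ne (mt (chartField_eq_zero_iff hψ _ hs).1 hp),
        cι.preimage_mem_nhds (ψ.open_source.mem_nhds hs)] with q hq hqs
      exact mt (chartField_eq_zero_iff hψ _ hqs).2 hq
    · rw [dense_iff_inter_open]
      intro O hO hne
      by_contra hc
      refine h0 (Subtype.ext (K.2.eq_zero_of_eqOn hN.1 hO hne fun p hp ↦ ?_))
      by_contra hKp
      exact hc ⟨p, hp, hKp⟩
  · rintro (hK | rfl)
    · exact fun p ↦ hN.normal_of_null (hinv K K.2 p) (hK.1 p)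
    · exact (g.normalIdeal hN.1 hinv).zero_mem

/-- The normal Killing fields of an invariant Killing horizon form a metabelian ideal. -/
theorem isSolvable_normalIdeal [ConnectedSpace M] (hN : g.IsNullHypersurface ι)
    (hinv : g.IsKillingInvariant ι) {L : SmoothVectorField (n + 1) M} (hL : g.IsKilling L)
    (hL0 : ∀ p, g.form (ι p) (L (ι p)) (L (ι p)) = 0) (hLne : ∀ p, L (ι p) ≠ 0) :
    LieAlgebra.IsSolvable (g.normalIdeal hN.1 hinv) := by
  have hLn : g.IsNormalTo ι L := fun p ↦ hN.normal_of_null (hinv L hL p) (hL0 p)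
  let P : SmoothVectorField (n + 1) M → Prop := fun K ↦ g.IsKilling K ∧ g.IsNormalTo ι K
  have hPL : P L := ⟨hL, hLn⟩
  have hP : ∀ {K₁ K₂}, P K₁ → P K₂ → P ⁅K₁, K₂⁆ := fun {K₁ K₂} h₁ h₂ ↦
    ⟨g.killingAlgebra.lie_mem h₁.1 h₂.1, IsNormalTo.lie hN.1 h₁.1 (hinv K₁ h₁.1) h₂.2⟩
  have main : ∀ a b c d, P a → P b → P c → P d → ∀ p, ⁅⁅a, b⁆, ⁅c, d⁆⁆ (ι p) = 0 := by
    intro a b c d ha hb hc hd p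
    -- `A K` will be the coefficient of `K` along `L` at the fixed point; off `P` its value is
    -- arbitrary.
    have ex : ∀ K, ∃ α : ℝ, P K → K (ι p) = α • L (ι p) := by
      intro K
      by_cases hK : P K
      · have hKt := hinv K hK.1 p
        obtain ⟨α, hα⟩ := g.exists_smul_eq_of_null (hLne p) (hL0 p) (hK.2 p _ hKt) (hLn p _ hKt)
        exact ⟨α, fun _ ↦ hα⟩
      · exact ⟨0, fun h ↦ absurd h hK⟩
    choose A hA using ex
    have inj : ∀ {s t : ℝ}, s • L (ι p) = t • L (ι p) → s = t := fun h ↦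
      smul_left_injective ℝ (hLne p) h
    have hlie : ∀ {K₁ K₂}, P K₁ → P K₂ →
        A ⁅K₁, K₂⁆ = A K₁ * A ⁅L, K₂⁆ - A K₂ * A ⁅L, K₁⁆ := by
      intro K₁ K₂ h₁ h₂
      apply inj
      rw [← hA _ (hP h₁ h₂), SmoothVectorField.lie_apply_of_smul (hA _ h₁) (hA _ h₂),
        hA _ (hP hPL h₁), hA _ (hP hPL h₂), sub_smul, mul_smul, mul_smul]
    obtain ⟨κ, hκ⟩ := hL.exists_ad_sq_eq hN.1 hLn hL0 (hLne p)
    have hsq : ∀ {K}, P K → A ⁅L, ⁅L, K⁆⁆ = κ * A ⁅L, K⁆ := fun {K} hK ↦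
      hκ K hK.1 _ _ _ (hA _ hK) (hA _ (hP hPL hK)) (hA _ (hP hPL (hP hPL hK)))
    -- Expand by the Leibniz rule: the products `A ⁅L, K₁⁆ * A ⁅L, K₂⁆` cancel, and `hsq` supplies
    -- the same `κ` in both remaining terms.
    have hder : ∀ {K₁ K₂}, P K₁ → P K₂ → A ⁅L, ⁅K₁, K₂⁆⁆ = κ * A ⁅K₁, K₂⁆ := by
      intro K₁ K₂ h₁ h₂
      have e : A ⁅L, ⁅K₁, K₂⁆⁆ = A ⁅⁅L, K₁⁆, K₂⁆ + A ⁅K₁, ⁅L, K₂⁆⁆ := by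
        apply inj
        rw [add_smul, ← hA _ (hP hPL (hP h₁ h₂)), ← hA _ (hP (hP hPL h₁) h₂),
          ← hA _ (hP h₁ (hP hPL h₂)), leibniz_lie]
        rfl
      rw [e, hlie (hP hPL h₁) h₂, hlie h₁ (hP hPL h₂), hlie h₁ h₂, hsq h₁, hsq h₂]
      ring
    rw [hA _ (hP (hP ha hb) (hP hc hd)), hlie (hP ha hb) (hP hc hd), hder ha hb, hder hc hd]
    have : A ⁅a, b⁆ * (κ * A ⁅c, d⁆) - A ⁅c, d⁆ * (κ * A ⁅a, b⁆) = 0 := by ring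
    rw [this, zero_smul]
  obtain ⟨p₀⟩ := hN.1.nonempty
  refine LieIdeal.isSolvable_of_lie_lie_eq_zero _ fun a ha b hb c hc d hd ↦ Subtype.ext ?_
  have hK : g.IsKilling (⁅⁅a, b⁆, ⁅c, d⁆⁆ : g.killingAlgebra) := Subtype.prop _
  -- Vanishing along the hypersurface propagates to all of the connected `M`.
  exact hK.eq_zero_of_eqOn hN.1 isOpen_univ ⟨p₀, mem_univ _⟩ fun p _ ↦
    main a b c d ⟨a.2, ha⟩ ⟨b.2, hb⟩ ⟨c.2, hc⟩ ⟨d.2, hd⟩ p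

end LorentzianMetric

end NormalKillingFields

end

/-! ### The main theorem -/

theorem mainTheorem6 {n : ℕ} {M : Type*} [TopologicalSpace M] [T2Space M]
    [SecondCountableTopology M] [ConnectedSpace M]
    [ChartedSpace (EuclideanSpace ℝ (Fin (n + 1))) M] [IsManifold (𝓡 (n + 1)) ∞ M]
    (g : LorentzianMetric (n + 1) M)
    {N : Type*} [TopologicalSpace N] [ChartedSpace (EuclideanSpace ℝ (Fin n)) N]
    [IsManifold (𝓡 n) ∞ N] (ι : N → M)
    (hH : g.IsKillingHorizon ι) (hinv : g.IsKillingInvariant ι) :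
    (∃ 𝔞 : LieIdeal ℝ g.killingAlgebra,
      (𝔞 : Set g.killingAlgebra) = g.generators ι ∧
        𝔞 ≤ LieAlgebra.radical ℝ g.killingAlgebra) ∧
    LieAlgebra.radical ℝ g.killingAlgebra ≠ ⊥ := by
  obtain ⟨hN, L, hL, hLH⟩ := hH
  have hmem : (⟨L, hL⟩ : g.killingAlgebra) ∈ g.normalIdeal hN.1 hinv := fun p ↦
    hN.normal_of_null (hLH p).2.1 (hLH p).1
  have hle : g.normalIdeal hN.1 hinv ≤ LieAlgebra.radical ℝ g.killingAlgebra :=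
    -- The radical is the supremum of the solvable ideals, so this inclusion needs no
    -- finite-dimensionality.
    le_sSup (LorentzianMetric.isSolvable_normalIdeal hN hinv hL (fun p ↦ (hLH p).1)
      fun p ↦ (hLH p).2.2)
  refine ⟨⟨g.normalIdeal hN.1 hinv, LorentzianMetric.coe_normalIdeal hN hinv, hle⟩, fun hbot ↦ ?_⟩
  obtain ⟨p⟩ := hN.1.nonempty
  have h0 : (⟨L, hL⟩ : g.killingAlgebra) = 0 := by
    have := hle hmem
    rwa [hbot, LieSubmodule.mem_bot] at this
  have hL0 : L = 0 := congrArg Subtype.val h0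
  exact (hLH p).2.2 (by rw [hL0]; rfl)
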